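/- Let $\Gamma$ be a finite connected, bridgeless, 3-valent graph (multiple edges allowed) embedded up to isotopy in the oriented sphere $S^2$, with vertex set $V$, edge set $E$ and set of half-edges $\vec E$. For an oriented edge $e$ write $s(e),t(e)$ for its source and target half-edges (and also for their end vertices). At each vertex the half-edges are cyclically ordered counter-clockwise; an angle $\alpha$ is a pair of distinct half-edges at the same vertex, and its source $s(\alpha)$ and target $t(\alpha)$ are such that $t(\alpha)$ follows $s(\alpha)$ in this order. Each face carries its counter-clockwise boundary orientation. An orientation of the edges is Kasteleyn if every face has an odd number of edges whose orientation does not match the one induced by the face. For real couplings $(y_e)_{e\in E}$ the Ising partition function is $$Z^{Ising}(\Gamma,\{y_e\})=\sum_{\sigma:V\to\{\pm1\}}\exp\Big(\sum_{e}y_e\,\sigma_{s(e)}\sigma_{t(e)}\Big).$$ Let $\psi_h,\bar\psi_h,\eta_h,\bar\eta_h$ $(h\in\vec E)$ be anticommuting variables. For an orientation of the edges and complex numbers $X_\alpha$ put $$Z^{\mathbb C}_f(\Gamma,\{X_\alpha\})=\int\prod_{h}d\psi_h\,d\bar\psi_h\;\exp\Big(\sum_{h}\psi_h\bar\psi_h-\sum_e\bar\psi_{s(e)}\bar\psi_{t(e)}+\sum_\alpha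 X_\alpha\,\psi_{s(\alpha)}\psi_{t(\alpha)}\Big),$$ where the Berezin integral is normalized by $\int\prod_h d\psi_h d\bar\psi_h\,\prod_h\psi_h\bar\psi_h=1$. (1) Fix a Kasteleyn orientation of $\Gamma$. Choose complex square roots $Y_e^{1/2}$ of $Y_e=\tanh y_e$ (one for each edge), and put $X_\alpha=Y_{e}^{1/2}\,Y_{e'}^{1/2}$, where $e,e'$ are the edges containing $s(\alpha),t(\alpha)$. Then $$Z^{Ising}(\Gamma,\{y_e\})=\Big(\prod_{e\in E}\cosh y_e\Big)\,2^{\#V}\,Z^{\mathbb C}_f(\Gamma,\{X_\alpha\}),$$ where $Z^{\mathbb C}_f$ is formed with the orientation opposite to the Kasteleyn one (that is, $s(e)$ and $t(e)$ in it are the half-edges at the head and at the tail of $e$). (2) For every orientation of the edges and all complex $X_\alpha$, $$Z^{\mathbb C}_f(\Gamma,\{X_\alpha\})^2=\int\prod_h d\psi_h\,d\eta_h\,d\bar\psi_h\,d\bar\eta_h\; e^{\sum_h(\psi_h\bar\eta_h+\bar\psi_h\eta_h)-\sum_e(\bar\psi_{s(e)}\bar\psi_{t(e)}+\bar\eta_{s(e)}\bar\eta_{t(e)})}\,e^{\sum_\alpha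 X_\alpha(\psi_{s(\alpha)}\psi_{t(\alpha)}+\eta_{s(\alpha)}\eta_{t(\alpha)})},$$ where $\int\prod_h d\psi_h d\eta_h d\bar\psi_h d\bar\eta_h\,\prod_h\psi_h\eta_h\bar\psi_h\bar\eta_h=1$. -/

import Mathlib

open scoped BigOperators

noncomputable section

/-! ## Finite graphs embedded in closed oriented surfaces -/

/-- A graph (multiple edges and loops allowed, no isolated vertices) with set of half-edges `H`,
drawn on an oriented surface up to isotopy: `rot h` is the half-edge that follows `h` in the
counter-clockwise order around the vertex of `h`, and `opp h` is the other half of the edge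
of `h`. -/
structure EmbeddedGraph (H : Type*) where
  rot : Equiv.Perm H
  opp : Equiv.Perm H
  opp_opp : ∀ h, opp (opp h) = h
  opp_ne : ∀ h, opp h ≠ h

namespace EmbeddedGraph

variable {H : Type*} (Γ : EmbeddedGraph H)

/-- Vertices: the cycles of `rot`. -/
def Vertex : Type _ := Quotient (Equiv.Perm.SameCycle.setoid Γ.rot)

/-- Edges: the pairs `{h, opp h}`. -/
def Edge : Type _ := Quotient (Equiv.Perm.SameCycle.setoid Γ.opp)

/-- Walking along the boundary of a face with the face on the left (counter-clockwise), the
half-edge `h` is left behind at its vertex, its edge is traversed towards the vertex of `opp h`,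
and there the next edge is entered through the half-edge preceding `opp h` in the
counter-clockwise order. -/
def faceNext : Equiv.Perm H := Γ.rot⁻¹ * Γ.opp

/-- Faces: the cycles of `faceNext`. A half-edge `h` in the cycle of a face stands for its edge,
traversed from `h` to `opp h` in the counter-clockwise orientation induced by that face. -/
def Face : Type _ := Quotient (Equiv.Perm.SameCycle.setoid Γ.faceNext)

/-- The vertex to which a half-edge is incident. -/
def vertex (h : H) : Γ.Vertex := Quotient.mk _ h

/-- The edge that contains a half-edge. -/
def edge (h : H) : Γ.Edge := Quotient.mk _ h

/-- The face on the left of the edge of `h`, traversed from `h` to `opp h`. -/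
def face (h : H) : Γ.Face := Quotient.mk _ h

instance [Finite H] : Finite Γ.Vertex := inferInstanceAs (Finite (Quotient _))
instance [Finite H] : Finite Γ.Edge := inferInstanceAs (Finite (Quotient _))
instance [Finite H] : Finite Γ.Face := inferInstanceAs (Finite (Quotient _))
instance [Finite H] : Fintype Γ.Vertex := Fintype.ofFinite _
instance [Finite H] : Fintype Γ.Edge := Fintype.ofFinite _
instance [Finite H] : DecidableEq Γ.Vertex := Classical.decEq _

lemma edge_opp (h : H) : Γ.edge (Γ.opp h) = Γ.edge h :=
  Quotient.sound (show Equiv.Perm.SameCycle Γ.opp (Γ.opp h) h from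
    ⟨1, by simpa using Γ.opp_opp h⟩)

/-- An angle: two distinct half-edges with the same endpoint that are consecutive in the
counter-clockwise order, written as the pair (source, target) in that order. At a vertex of
valency three these are all the pairs of distinct half-edges. -/
def Angle : Type _ := {p : H × H // p.1 ≠ p.2 ∧ p.2 = Γ.rot p.1}

instance [Finite H] : Finite Γ.Angle := inferInstanceAs (Finite {_p : H × H // _})
instance [Finite H] : Fintype Γ.Angle := Fintype.ofFinite _

/-- The source half-edge of an angle. -/
def Angle.source {Γ : EmbeddedGraph H} (α : Γ.Angle) : H := α.1.1

/-- The target half-edge of an angle. -/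
def Angle.target {Γ : EmbeddedGraph H} (α : Γ.Angle) : H := α.1.2

/-- `u` and `v` are joined by a path that uses only edges from `S`. -/
def Joined (S : Set Γ.Edge) (u v : Γ.Vertex) : Prop :=
  Relation.ReflTransGen
    (fun a b => ∃ h, Γ.edge h ∈ S ∧ Γ.vertex h = a ∧ Γ.vertex (Γ.opp h) = b) u v

/-- The graph is connected. -/
def IsConnected : Prop := Nonempty Γ.Vertex ∧ ∀ u v, Γ.Joined Set.univ u v

/-- No edge disconnects the graph when it is removed. -/
def IsBridgeless : Prop := ∀ (e : Γ.Edge) (u v : Γ.Vertex),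
  Γ.Joined Set.univ u v → Γ.Joined {e}ᶜ u v

/-- Every vertex has exactly three half-edges attached to it. -/
def IsTrivalent : Prop := ∀ v : Γ.Vertex, Nat.card {h : H // Γ.vertex h = v} = 3

/-- The graph is connected and drawn on the sphere: the closed surface obtained from the thickened
graph by gluing a disc to each face is connected, and has Euler characteristic two. -/
def IsPlanar : Prop :=
  Γ.IsConnected ∧
    (Nat.card Γ.Vertex : ℤ) - (Nat.card Γ.Edge : ℤ) + (Nat.card Γ.Face : ℤ) = 2

/-- An orientation of the edges: the choice of the source half-edge of every edge. -/
structure Orientation where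
  source : Γ.Edge → H
  edge_source : ∀ e, Γ.edge (source e) = e

namespace Orientation

variable {Γ} (o : Γ.Orientation)

/-- The target half-edge of an oriented edge. -/
def target (e : Γ.Edge) : H := Γ.opp (o.source e)

/-- The opposite orientation: all edges are reversed. -/
def reverse : Γ.Orientation where
  source := o.target
  edge_source e := (Γ.edge_opp _).trans (o.edge_source e)

/-- Every face has an odd number of edges whose orientation does not match the counter-clockwise
orientation induced by the face, i.e. which the boundary walk of the face traverses from their
target to their source. -/
def IsKasteleyn : Prop :=
  ∀ f : Γ.Face, Odd (Nat.card {e : Γ.Edge // Γ.face (o.target e) = f})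

end Orientation

/-- The exponent `∑ e, y e * σ (s e) * σ (t e)` for a spin configuration `σ` with values `1` and
`-1`. It does not depend on the orientation, which only names the two ends of an edge. -/
def isingEnergy (y : Γ.Edge → ℝ) (o : Γ.Orientation) [Finite H] (σ : Γ.Vertex → ℤˣ) : ℝ :=
  ∑ e, y e * ((σ (Γ.vertex (o.source e)) : ℤ) : ℝ) * ((σ (Γ.vertex (o.target e)) : ℤ) : ℝ)

/-- The partition function of the Ising model with couplings `y`. -/
def isingZ (y : Γ.Edge → ℝ) (o : Γ.Orientation) [Finite H] : ℝ :=
  ∑ σ : Γ.Vertex → ℤˣ, Real.exp (Γ.isingEnergy y o σ)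

end EmbeddedGraph

/-! ## Grassmann variables and Berezin integration -/

/-- The complex Grassmann algebra on anticommuting variables indexed by `I`. -/
abbrev Grassmann (I : Type*) : Type _ := ExteriorAlgebra ℂ (I →₀ ℂ)

namespace Grassmann

variable {I : Type*}

/-- The Grassmann variable with index `i`. -/
def gen (i : I) : Grassmann I := ExteriorAlgebra.ι ℂ (Finsupp.single i 1)

/-- The left derivative `∂/∂θᵢ`: the antiderivation with `∂ θⱼ / ∂θᵢ = δᵢⱼ`. -/
def deriv (i : I) : Grassmann I →ₗ[ℂ] Grassmann I :=
  CliffordAlgebra.contractLeft (Finsupp.lapply i)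

/-- The constant term of an element of the Grassmann algebra. -/
def constTerm : Grassmann I →ₗ[ℂ] ℂ := ExteriorAlgebra.algebraMapInv.toLinearMap

/-- The Berezin integral `∫ dθ_{i₁} ⋯ dθ_{iₙ} f` for `l = [i₁, …, iₙ]`, a list of all the indices:
the iterated left derivative `∂_{i₁} ⋯ ∂_{iₙ} f`, which is a number. -/
def berezin (l : List I) (f : Grassmann I) : ℂ :=
  constTerm (l.foldr (fun i g => deriv i g) f)

end Grassmann

/-- The two kinds of variables attached to a half-edge: `ψ` and `ψ̄`. -/
inductive Fermion₂
  | psi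
  | psiBar

/-- The four kinds of variables attached to a half-edge: `ψ`, `η`, `ψ̄` and `η̄`. -/
inductive Fermion₄
  | psi
  | eta
  | psiBar
  | etaBar

namespace EmbeddedGraph

open Grassmann

variable {H : Type*} [Fintype H] (Γ : EmbeddedGraph H)

/-- The exponent
`∑_h ψ_h ψ̄_h - ∑_e ψ̄_{s(e)} ψ̄_{t(e)} + ∑_α X_α ψ_{s(α)} ψ_{t(α)}`. -/
def complexAction (o : Γ.Orientation) (X : Γ.Angle → ℂ) : Grassmann (H × Fermion₂) :=
  ∑ h, gen (h, .psi) * gen (h, .psiBar)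
    - ∑ e, gen (o.source e, .psiBar) * gen (o.target e, .psiBar)
    + ∑ α : Γ.Angle, X α • (gen (α.source, .psi) * gen (α.target, .psi))

/-- The order of integration `∏_h dψ_h dψ̄_h`. The factors of this product are even, so that the
order in which the half-edges are listed is irrelevant. As the number of half-edges is even,
`∏_h ψ_h ψ̄_h` has integral one. -/
def complexMeasure (H : Type*) [Fintype H] : List (H × Fermion₂) :=
  (Finset.univ : Finset H).toList.flatMap fun h => [(h, .psi), (h, .psiBar)]

/-- The complex fermionic integral `Z_f^ℂ(Γ, {X_α})`. -/
def fermionZ (o : Γ.Orientation) (X : Γ.Angle → ℂ) : ℂ :=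
  berezin (complexMeasure H) (IsNilpotent.exp (Γ.complexAction o X))

/-- The quadratic and edge part of the doubled exponent,
`∑_h (ψ_h η̄_h + ψ̄_h η_h) - ∑_e (ψ̄_{s(e)} ψ̄_{t(e)} + η̄_{s(e)} η̄_{t(e)})`. -/
def doubledEdgeAction (o : Γ.Orientation) : Grassmann (H × Fermion₄) :=
  ∑ h, (gen (h, .psi) * gen (h, .etaBar) + gen (h, .psiBar) * gen (h, .eta))
    - ∑ e, (gen (o.source e, .psiBar) * gen (o.target e, .psiBar)
        + gen (o.source e, .etaBar) * gen (o.target e, .etaBar))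

/-- The angle part of the doubled exponent, `∑_α X_α (ψ_{s(α)} ψ_{t(α)} + η_{s(α)} η_{t(α)})`. -/
def doubledAngleAction (X : Γ.Angle → ℂ) : Grassmann (H × Fermion₄) :=
  ∑ α : Γ.Angle, X α • (gen (α.source, .psi) * gen (α.target, .psi)
    + gen (α.source, .eta) * gen (α.target, .eta))

/-- The order of integration `∏_h dψ_h dη_h dψ̄_h dη̄_h`. The factors are even, so that the
order in which the half-edges are listed is irrelevant, and `∏_h ψ_h η_h ψ̄_h η̄_h` has
integral one. -/
def doubledMeasure (H : Type*) [Fintype H] : List (H × Fermion₄) :=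
  (Finset.univ : Finset H).toList.flatMap fun h =>
    [(h, .psi), (h, .eta), (h, .psiBar), (h, .etaBar)]

/-- The doubled fermionic integral over the variables `ψ, η, ψ̄, η̄`. -/
def doubledFermionZ (o : Γ.Orientation) (X : Γ.Angle → ℂ) : ℂ :=
  berezin (doubledMeasure H)
    (IsNilpotent.exp (Γ.doubledEdgeAction o) * IsNilpotent.exp (Γ.doubledAngleAction X))

end EmbeddedGraph

end

/-!
Both sides of the first identity are equal to the sum of `∏ e ∈ S, tanh (y e)` over the sets `S` of
edges that meet every vertex in an even number of half-edges, up to the common prefactor. For the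
Ising model this is the high-temperature expansion (`isingZ_eq_sum_even`). For the fermion, the
exponential of the quadratic action is a sum over sets of its monomials ("dimers"), and only sets
that cover every variable exactly once have nonzero integral; these correspond to the even sets
`S` (`exists_even_of_berezin_ne_zero`). What remains is a sign for each `S`: it compares the
product of the `ψ`-variables of `S`, paired at the vertices, with their product paired along the
edges. The claim is that this sign is always `+1` (`prod_angle_pair_eq_prod_edge_pair`).

The sign is that of a permutation, so it may be computed with anticommuting elements of square one
instead of Grassmann variables. In that Clifford algebra the products over angles and over edges
are multiplicative up to signs: adding an angle `(a, rot a)` to `S` modulo two costs the sign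
`(-1) ^ S a` (`angleProd_mul`), and adding an edge costs a sign exactly if it belongs to `S`
(`edgeProd_mul`). Along the boundary of a face these signs cancel, because every half-edge of the
boundary walk is the source of exactly one angle of the face. So adding the boundary of a face
preserves the sign of `S`, once the boundary itself has sign `+1`, and this is the Kasteleyn
condition (`angleProd_eq_edgeProd_add_face`).

Planarity enters through homology over `ℤ/2`: Euler's formula makes every even set a sum of face
boundaries (`IsPlanar.exists_faceBoundary`). The same fact shows that in a bridgeless graph the
two sides of an edge are different faces (`IsPlanar.face_opp_ne`), so that no face visits a vertex
twice. In this way no form of the Jordan curve theorem is needed.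

The second identity is a change of variables: after the substitution `ψ̄ ↦ -ψ̄` the doubled exponent
is the sum of two copies of the complex one in independent variables, and the sign of the Jacobian
is `+1` since the number of half-edges is even (`fermionZ_sq`).
-/

noncomputable section

universe u

/-! ### Contraction, substitution and parity in the Grassmann algebra -/

namespace Grassmann

variable {I J : Type*}

section Contraction

open CliffordAlgebra

/-- Contraction with a linear form is an antiderivation. -/
lemma contractLeft_mul {M : Type*} [AddCommGroup M] [Module ℂ M] (d : Module.Dual ℂ M)
    (a b : ExteriorAlgebra ℂ M) :
    contractLeft d (a * b) = contractLeft d a * b + involute a * contractLeft d b := by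
  induction a using CliffordAlgebra.left_induction with
  | algebraMap r =>
    simp [contractLeft_algebraMap_mul, contractLeft_algebraMap]
  | add x y hx hy =>
    simp only [add_mul, map_add, hx, hy]; abel
  | ι_mul x m hx =>
    rw [mul_assoc, contractLeft_ι_mul, contractLeft_ι_mul, hx]
    simp only [map_mul, involute_ι]
    simp only [sub_mul, mul_add, smul_mul_assoc, neg_mul, mul_assoc]
    abel

lemma map_involute {M N : Type*} [AddCommGroup M] [Module ℂ M] [AddCommGroup N] [Module ℂ N]
    (f : M →ₗ[ℂ] N) (a : ExteriorAlgebra ℂ M) :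
    ExteriorAlgebra.map f (involute a) = involute (ExteriorAlgebra.map f a) := by
  induction a using CliffordAlgebra.left_induction with
  | algebraMap r => simp
  | add x y hx hy => simp [hx, hy]
  | ι_mul x m hx =>
    have h (m : M) : ExteriorAlgebra.map f (CliffordAlgebra.ι 0 m) = CliffordAlgebra.ι 0 (f m) :=
      ExteriorAlgebra.map_apply_ι f m
    simp [hx, involute_ι, h]

lemma contractLeft_map {M N : Type*} [AddCommGroup M] [Module ℂ M] [AddCommGroup N] [Module ℂ N]
    (f : M →ₗ[ℂ] N) (d : Module.Dual ℂ N) (a : ExteriorAlgebra ℂ M) :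
    contractLeft d (ExteriorAlgebra.map f a) = ExteriorAlgebra.map f (contractLeft (d ∘ₗ f) a) := by
  have h (m : M) : ExteriorAlgebra.map f (CliffordAlgebra.ι 0 m) = CliffordAlgebra.ι 0 (f m) :=
      ExteriorAlgebra.map_apply_ι f m
  induction a using CliffordAlgebra.left_induction with
  | algebraMap r => simp [contractLeft_algebraMap]
  | add x y hx hy => simp [hx, hy]
  | ι_mul x m hx => simp [h, contractLeft_ι_mul, hx]

end Contraction

lemma gen_mul_gen (i j : I) : gen i * gen j = -(gen j * gen i : Grassmann I) :=
  eq_neg_of_add_eq_zero_left (ExteriorAlgebra.ι_add_mul_swap _ _)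

lemma gen_mul_self (i : I) : gen i * gen i = (0 : Grassmann I) :=
  ExteriorAlgebra.ι_sq_zero _

lemma deriv_mul (i : I) (a b : Grassmann I) :
    deriv i (a * b) = deriv i a * b + CliffordAlgebra.involute a * deriv i b :=
  contractLeft_mul _ a b

lemma deriv_gen_mul_self (i : I) (y : Grassmann I) :
    deriv i (gen i * y) = y - gen i * deriv i y := by
  simp [deriv, gen, ExteriorAlgebra.ι, CliffordAlgebra.contractLeft_ι_mul]

lemma deriv_gen_mul_of_ne {i j : I} (h : i ≠ j) (y : Grassmann I) :
    deriv i (gen j * y) = -(gen j * deriv i y) := by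
  have h' : j ≠ i := h.symm
  simp [deriv, gen, ExteriorAlgebra.ι, CliffordAlgebra.contractLeft_ι_mul, h']

lemma deriv_one (i : I) : deriv i (1 : Grassmann I) = 0 :=
  CliffordAlgebra.contractLeft_one ..

lemma deriv_comm (i j : I) (x : Grassmann I) : deriv i (deriv j x) = -deriv j (deriv i x) :=
  CliffordAlgebra.contractLeft_comm ..

/-- The product of two Grassmann variables is even, hence central. -/
lemma gen_mul_gen_mem_center (i j : I) :
    (gen i * gen j : Grassmann I) ∈ Subalgebra.center ℂ (Grassmann I) := by
  rw [Subalgebra.mem_center_iff]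
  intro b
  induction b using CliffordAlgebra.left_induction with
  | algebraMap r => exact Algebra.commutes r _
  | add x y hx hy => rw [add_mul, mul_add, hx, hy]
  | ι_mul x m hx =>
    have h (k : I) : (CliffordAlgebra.ι 0 m : Grassmann I) * gen k
        = -(gen k * CliffordAlgebra.ι 0 m) :=
      eq_neg_of_add_eq_zero_left (ExteriorAlgebra.ι_add_mul_swap _ _)
    calc _ = CliffordAlgebra.ι 0 m * (x * (gen i * gen j)) := by rw [mul_assoc]
      _ = (CliffordAlgebra.ι 0 m * gen i) * gen j * x := by rw [hx]; simp only [mul_assoc]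
      _ = -(gen i * (CliffordAlgebra.ι 0 m * gen j)) * x := by
        rw [h]; simp only [neg_mul, mul_assoc]
      _ = _ := by rw [h]; simp only [mul_neg, neg_neg, mul_assoc]

/-- The substitution of linear combinations `v i` of new variables for the Grassmann variables. -/
def subst (v : I → (J →₀ ℂ)) : Grassmann I →ₐ[ℂ] Grassmann J :=
  ExteriorAlgebra.map (Finsupp.linearCombination ℂ v)

lemma subst_gen (v : I → (J →₀ ℂ)) (i : I) : subst v (gen i) = ExteriorAlgebra.ι ℂ (v i) := by
  simp [subst, gen]

lemma constTerm_subst (v : I → (J →₀ ℂ)) (x : Grassmann I) :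
    constTerm (subst v x) = constTerm x := by
  have : (ExteriorAlgebra.algebraMapInv.comp (subst v) : Grassmann I →ₐ[ℂ] ℂ)
      = ExteriorAlgebra.algebraMapInv := by
    apply ExteriorAlgebra.hom_ext
    ext i
    simp [subst, ExteriorAlgebra.algebraMapInv]
  exact DFunLike.congr_fun this x

lemma constTerm_mul (x y : Grassmann I) : constTerm (x * y) = constTerm x * constTerm y :=
  map_mul ExteriorAlgebra.algebraMapInv x y

lemma deriv_subst_mul_subst {I' : Type*} (v : I → (J →₀ ℂ)) (w : I' → (J →₀ ℂ)) (j : J)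
    (a : Grassmann I) (b : Grassmann I') :
    deriv j (subst v a * subst w b) =
      subst v (CliffordAlgebra.contractLeft
          (Finsupp.lapply j ∘ₗ Finsupp.linearCombination ℂ v) a) * subst w b
        + subst v (CliffordAlgebra.involute a) * subst w (CliffordAlgebra.contractLeft
          (Finsupp.lapply j ∘ₗ Finsupp.linearCombination ℂ w) b) := by
  rw [deriv_mul, subst, subst, deriv, contractLeft_map, contractLeft_map, map_involute]

end Grassmann

namespace EmbeddedGraph

open Grassmann

variable {H : Type*}

/-- The variables of the first copy of the complex fermion inside the doubled system:
`ψ ↦ ψ`, `ψ̄ ↦ η̄`. -/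
def firstCopy : H × Fermion₂ → (H × Fermion₄ →₀ ℂ)
  | (h, .psi) => Finsupp.single (h, .psi) 1
  | (h, .psiBar) => Finsupp.single (h, .etaBar) 1

/-- The variables of the second copy of the complex fermion inside the doubled system:
`ψ ↦ η`, `ψ̄ ↦ -ψ̄`. The sign turns `ψ ψ̄` into `ψ̄ η`. -/
def secondCopy : H × Fermion₂ → (H × Fermion₄ →₀ ℂ)
  | (h, .psi) => Finsupp.single (h, .eta) 1
  | (h, .psiBar) => Finsupp.single (h, .psiBar) (-1)

lemma lapply_psi_firstCopy (h : H) :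
    Finsupp.lapply (h, Fermion₄.psi) ∘ₗ Finsupp.linearCombination ℂ (firstCopy (H := H))
      = Finsupp.lapply (h, Fermion₂.psi) := by
  classical
  ext ⟨k, _ | _⟩ <;> simp [firstCopy, Finsupp.single_apply]

lemma lapply_eta_firstCopy (h : H) :
    Finsupp.lapply (h, Fermion₄.eta) ∘ₗ Finsupp.linearCombination ℂ (firstCopy (H := H)) = 0 := by
  ext ⟨k, _ | _⟩ <;> simp [firstCopy]

lemma lapply_psiBar_firstCopy (h : H) :
    Finsupp.lapply (h, Fermion₄.psiBar) ∘ₗ Finsupp.linearCombination ℂ (firstCopy (H := H))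
      = 0 := by
  ext ⟨k, _ | _⟩ <;> simp [firstCopy]

lemma lapply_etaBar_firstCopy (h : H) :
    Finsupp.lapply (h, Fermion₄.etaBar) ∘ₗ Finsupp.linearCombination ℂ (firstCopy (H := H))
      = Finsupp.lapply (h, Fermion₂.psiBar) := by
  classical
  ext ⟨k, _ | _⟩ <;> simp [firstCopy, Finsupp.single_apply]

lemma lapply_psi_secondCopy (h : H) :
    Finsupp.lapply (h, Fermion₄.psi) ∘ₗ Finsupp.linearCombination ℂ (secondCopy (H := H)) = 0 := by
  ext ⟨k, _ | _⟩ <;> simp [secondCopy]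

lemma lapply_eta_secondCopy (h : H) :
    Finsupp.lapply (h, Fermion₄.eta) ∘ₗ Finsupp.linearCombination ℂ (secondCopy (H := H))
      = Finsupp.lapply (h, Fermion₂.psi) := by
  classical
  ext ⟨k, _ | _⟩ <;> simp [secondCopy, Finsupp.single_apply]

lemma lapply_psiBar_secondCopy (h : H) :
    Finsupp.lapply (h, Fermion₄.psiBar) ∘ₗ Finsupp.linearCombination ℂ (secondCopy (H := H))
      = -Finsupp.lapply (h, Fermion₂.psiBar) := by
  classical
  ext ⟨k, _ | _⟩ <;> simp [secondCopy, Finsupp.single_apply]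

lemma lapply_etaBar_secondCopy (h : H) :
    Finsupp.lapply (h, Fermion₄.etaBar) ∘ₗ Finsupp.linearCombination ℂ (secondCopy (H := H))
      = 0 := by
  ext ⟨k, _ | _⟩ <;> simp [secondCopy]

/-- For each half-edge the four derivatives of the doubled system act as the two derivatives on each
copy, up to the sign `-1` that comes from `secondCopy`. -/
lemma foldr_deriv_doubled (l : List H) (a b : Grassmann (H × Fermion₂)) :
    (l.flatMap fun h => [(h, Fermion₄.psi), (h, .eta), (h, .psiBar), (h, .etaBar)]).foldr
        (fun i g => deriv i g) (subst firstCopy a * subst secondCopy b) =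
      (-1 : ℂ) ^ l.length •
        (subst firstCopy ((l.flatMap fun h => [(h, Fermion₂.psi), (h, .psiBar)]).foldr
            (fun i g => deriv i g) a) *
          subst secondCopy ((l.flatMap fun h => [(h, Fermion₂.psi), (h, .psiBar)]).foldr
            (fun i g => deriv i g) b)) := by
  induction l with
  | nil => simp
  | cons h l ih =>
    simp only [List.flatMap_cons, List.foldr_append, ih, List.foldr_cons, List.foldr_nil, map_smul,
      List.length_cons]
    set a' := (l.flatMap fun h => [(h, Fermion₂.psi), (h, .psiBar)]).foldr
            (fun i g => deriv i g) a
    set b' := (l.flatMap fun h => [(h, Fermion₂.psi), (h, .psiBar)]).foldr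
            (fun i g => deriv i g) b
    rw [pow_succ, mul_smul, neg_one_smul]
    congr 1
    simp only [deriv_subst_mul_subst, lapply_psi_firstCopy, lapply_eta_firstCopy,
      lapply_psiBar_firstCopy, lapply_etaBar_firstCopy, lapply_psi_secondCopy,
      lapply_eta_secondCopy, lapply_psiBar_secondCopy, lapply_etaBar_secondCopy, map_zero,
      LinearMap.zero_apply, zero_mul, mul_zero, add_zero, zero_add, map_neg, LinearMap.neg_apply,
      mul_neg, CliffordAlgebra.involute_involute]
    rfl

/-- Half-edges are paired off by `opp`, so their number is even. -/
lemma even_card_halfEdges [Fintype H] (Γ : EmbeddedGraph H) : Even (Fintype.card H) := by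
  classical
  have h2 : (2 : ℕ) ∣ Fintype.card H := by
    have := Equiv.Perm.card_fixedPoints_modEq (p := 2) (n := 1) (f := (Γ.opp : H → H))
      (funext fun h => Γ.opp_opp h)
    rw [(Fintype.card_eq_zero_iff (α := Function.fixedPoints Γ.opp)).2
      ⟨fun x => Γ.opp_ne x.1 x.2⟩] at this
    exact (Nat.modEq_zero_iff_dvd.1 this)
  exact even_iff_two_dvd.2 h2

lemma berezin_doubledMeasure [Fintype H] (Γ : EmbeddedGraph H) (a b : Grassmann (H × Fermion₂)) :
    berezin (doubledMeasure H) (subst firstCopy a * subst secondCopy b)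
      = berezin (complexMeasure H) a * berezin (complexMeasure H) b := by
  rw [berezin, doubledMeasure, foldr_deriv_doubled, Finset.length_toList, Finset.card_univ,
    Γ.even_card_halfEdges.neg_one_pow, one_smul, constTerm_mul, constTerm_subst, constTerm_subst]
  rfl

end EmbeddedGraph

/-! ### The square of the fermionic integral -/

namespace Grassmann

variable {I J : Type*}

lemma gen_mul_gen_sq (i j : I) : (gen i * gen j : Grassmann I) ^ 2 = 0 := by
  rw [pow_two, mul_assoc, ← mul_assoc (gen j), gen_mul_gen j i, neg_mul, mul_neg, mul_assoc,
    gen_mul_self]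
  simp

variable (I) in
/-- The central nilpotent elements. On them the exponential turns sums into products. -/
def centralNilpotent : Submodule ℂ (Grassmann I) where
  carrier := {x | x ∈ Subalgebra.center ℂ (Grassmann I) ∧ IsNilpotent x}
  add_mem' hx hy := ⟨add_mem hx.1 hy.1,
    Commute.isNilpotent_add (Subalgebra.mem_center_iff.1 hy.1 _) hx.2 hy.2⟩
  zero_mem' := ⟨zero_mem _, IsNilpotent.zero⟩
  smul_mem' c _ hx := ⟨Subalgebra.smul_mem _ hx.1 c, hx.2.smul c⟩

lemma gen_mul_gen_mem (i j : I) : (gen i * gen j : Grassmann I) ∈ centralNilpotent I :=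
  ⟨gen_mul_gen_mem_center i j, 2, gen_mul_gen_sq i j⟩

lemma exp_add {x y : Grassmann I} (hx : x ∈ centralNilpotent I) (hy : y ∈ centralNilpotent I) :
    IsNilpotent.exp (x + y) = IsNilpotent.exp x * IsNilpotent.exp y :=
  IsNilpotent.exp_add_of_commute (Subalgebra.mem_center_iff.1 hy.1 _) hx.2 hy.2

lemma subst_exp (v : I → (J →₀ ℂ)) {x : Grassmann I} (hx : x ∈ centralNilpotent I) :
    subst v (IsNilpotent.exp x) = IsNilpotent.exp (subst v x) :=
  IsNilpotent.map_exp hx.2 _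

end Grassmann

namespace EmbeddedGraph

open Grassmann

variable {H : Type*}

lemma subst_firstCopy_gen (h : H) :
    subst firstCopy (gen (h, .psi)) = gen (h, Fermion₄.psi) ∧
      subst firstCopy (gen (h, .psiBar)) = gen (h, Fermion₄.etaBar) := by
  constructor <;> rw [subst_gen] <;> simp [firstCopy, gen]

lemma subst_secondCopy_gen (h : H) :
    subst secondCopy (gen (h, .psi)) = gen (h, Fermion₄.eta) ∧
      subst secondCopy (gen (h, .psiBar)) = -gen (h, Fermion₄.psiBar) := by
  constructor <;> rw [subst_gen] <;> simp [secondCopy, gen]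

variable [Fintype H] (Γ : EmbeddedGraph H)

lemma complexAction_mem (o : Γ.Orientation) (X : Γ.Angle → ℂ) :
    Γ.complexAction o X ∈ centralNilpotent (H × Fermion₂) :=
  add_mem (sub_mem (sum_mem fun _ _ => gen_mul_gen_mem _ _)
      (sum_mem fun _ _ => gen_mul_gen_mem _ _))
    (sum_mem fun _ _ => Submodule.smul_mem _ _ (gen_mul_gen_mem _ _))

lemma doubledEdgeAction_mem (o : Γ.Orientation) :
    Γ.doubledEdgeAction o ∈ centralNilpotent (H × Fermion₄) :=
  sub_mem (sum_mem fun _ _ => add_mem (gen_mul_gen_mem _ _) (gen_mul_gen_mem _ _))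
    (sum_mem fun _ _ => add_mem (gen_mul_gen_mem _ _) (gen_mul_gen_mem _ _))

lemma doubledAngleAction_mem (X : Γ.Angle → ℂ) :
    Γ.doubledAngleAction X ∈ centralNilpotent (H × Fermion₄) :=
  sum_mem fun _ _ => Submodule.smul_mem _ _ (add_mem (gen_mul_gen_mem _ _) (gen_mul_gen_mem _ _))

/-- The doubled exponent is the sum of two copies of the complex one in independent variables. -/
lemma doubledAction_eq (o : Γ.Orientation) (X : Γ.Angle → ℂ) :
    Γ.doubledEdgeAction o + Γ.doubledAngleAction X =
      subst firstCopy (Γ.complexAction o X) + subst secondCopy (Γ.complexAction o X) := by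
  simp only [complexAction, doubledEdgeAction, doubledAngleAction, map_add, map_sub, map_sum,
    map_mul, map_smul, (subst_firstCopy_gen _).1, (subst_firstCopy_gen _).2,
    (subst_secondCopy_gen _).1, (subst_secondCopy_gen _).2, smul_add, Finset.sum_add_distrib,
    gen_mul_gen (_, Fermion₄.psiBar) (_, Fermion₄.eta), neg_mul, mul_neg, neg_neg]
  abel

theorem fermionZ_sq (o : Γ.Orientation) (X : Γ.Angle → ℂ) :
    Γ.fermionZ o X ^ 2 = Γ.doubledFermionZ o X := by
  have hA := Γ.complexAction_mem o X
  rw [doubledFermionZ, ← exp_add (Γ.doubledEdgeAction_mem o) (Γ.doubledAngleAction_mem X),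
    doubledAction_eq, IsNilpotent.exp_add_of_commute _ (hA.2.map _) (hA.2.map _), ← subst_exp _ hA,
    ← subst_exp _ hA, Γ.berezin_doubledMeasure, pow_two]
  · rfl
  · have hsum : subst firstCopy (Γ.complexAction o X) ∈ centralNilpotent (H × Fermion₄) := by
      simp only [complexAction, map_add, map_sub, map_sum, map_mul, map_smul,
        (subst_firstCopy_gen _).1, (subst_firstCopy_gen _).2]
      exact add_mem (sub_mem (sum_mem fun _ _ => gen_mul_gen_mem _ _)
        (sum_mem fun _ _ => gen_mul_gen_mem _ _))
        (sum_mem fun _ _ => Submodule.smul_mem _ _ (gen_mul_gen_mem _ _))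
    exact (Subalgebra.mem_center_iff.1 hsum.1 _).symm

end EmbeddedGraph

/-! ### Expansion of Gaussian Berezin integrals into dimers -/

namespace Grassmann

variable {I D : Type*}

/-- The product `θᵢ θⱼ` of two Grassmann variables as an element of the center, where products
do not depend on an order of the factors. -/
def pair (i j : I) : Subalgebra.center ℂ (Grassmann I) :=
  ⟨gen i * gen j, gen_mul_gen_mem_center i j⟩

lemma coe_pair_mul (i j : I) (p : Subalgebra.center ℂ (Grassmann I)) :
    ((pair i j * p : Subalgebra.center ℂ (Grassmann I)) : Grassmann I) = gen i * (gen j * p) := by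
  rw [Subalgebra.coe_mul, pair, mul_assoc]

lemma pair_swap (i j : I) : pair i j = (-1 : ℂ) • pair j i :=
  Subtype.ext ((gen_mul_gen i j).trans (neg_one_smul ℂ (gen j * gen i : Grassmann I)).symm)

lemma exp_smul_pair (c : ℂ) (i j : I) :
    IsNilpotent.exp (c • (gen i * gen j) : Grassmann I)
      = ((1 + c • pair i j : Subalgebra.center ℂ (Grassmann I)) : Grassmann I) := by
  rw [IsNilpotent.exp_eq_sum (k := 2) (by rw [smul_pow, gen_mul_gen_sq, smul_zero])]
  simp [Finset.sum_range_succ, pair]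

lemma exp_sum_pair (s : Finset D) (a b : D → I) (w : D → ℂ) :
    IsNilpotent.exp (∑ d ∈ s, w d • (gen (a d) * gen (b d)) : Grassmann I)
      = ((∏ d ∈ s, (1 + w d • pair (a d) (b d)) : Subalgebra.center ℂ (Grassmann I)) :
        Grassmann I) := by
  classical
  induction s using Finset.induction_on with
  | empty => simp [IsNilpotent.exp_zero]
  | insert d s hd ih =>
    rw [Finset.sum_insert hd, Finset.prod_insert hd, exp_add, ih, exp_smul_pair, Subalgebra.coe_mul]
    · exact Submodule.smul_mem _ _ (gen_mul_gen_mem _ _)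
    · exact sum_mem fun _ _ => Submodule.smul_mem _ _ (gen_mul_gen_mem _ _)

lemma exists_linearMap_eq_berezin (l : List I) :
    ∃ φ : Grassmann I →ₗ[ℂ] ℂ, ∀ f, berezin l f = φ f := by
  have h : ∃ φ : Grassmann I →ₗ[ℂ] Grassmann I, ∀ f, l.foldr (fun i g => deriv i g) f = φ f := by
    induction l with
    | nil => exact ⟨LinearMap.id, fun f => rfl⟩
    | cons i l ih =>
      obtain ⟨φ, hφ⟩ := ih
      exact ⟨deriv i ∘ₗ φ, fun f => by rw [List.foldr_cons, hφ]; rfl⟩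
  obtain ⟨φ, hφ⟩ := h
  exact ⟨constTerm ∘ₗ φ, fun f => by rw [berezin, hφ]; rfl⟩

lemma berezin_smul (l : List I) (z : ℂ) (f : Grassmann I) :
    berezin l (z • f) = z * berezin l f := by
  obtain ⟨φ, hφ⟩ := exists_linearMap_eq_berezin l
  rw [hφ, hφ, map_smul, smul_eq_mul]

/-- The integral of the exponential of a quadratic form is a sum over sets of dimers: each
monomial of the quadratic form is a dimer, which covers its two variables. -/
lemma berezin_exp_sum_pair [Fintype D] (l : List I) (a b : D → I) (w : D → ℂ) :
    berezin l (IsNilpotent.exp (∑ d, w d • (gen (a d) * gen (b d)) : Grassmann I))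
      = ∑ K : Finset D, (∏ d ∈ K, w d) *
        berezin l ((∏ d ∈ K, pair (a d) (b d) : Subalgebra.center ℂ (Grassmann I)) :
          Grassmann I) := by
  obtain ⟨φ, hφ⟩ := exists_linearMap_eq_berezin l
  rw [exp_sum_pair, Finset.prod_one_add, Finset.powerset_univ]
  simp only [hφ, Finset.prod_smul, AddSubmonoidClass.coe_finsetSum, map_sum]
  refine Finset.sum_congr rfl fun K _ => ?_
  rw [← smul_eq_mul, ← map_smul]
  rfl

/-- The derivatives anticommute, so the one that vanishes on `f` can be moved to act first. -/
lemma foldr_deriv_eq_zero {i : I} {l : List I} (hi : i ∈ l) {f : Grassmann I}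
    (hf : deriv i f = 0) : l.foldr (fun i g => deriv i g) f = 0 := by
  have key (l : List I) : deriv i (l.foldr (fun i g => deriv i g) f) = 0 := by
    induction l with
    | nil => exact hf
    | cons j l ih => rw [List.foldr_cons, deriv_comm, ih, map_zero, neg_zero]
  induction l with
  | nil => simp at hi
  | cons j l ih =>
    rcases List.mem_cons.1 hi with rfl | h
    · exact key l
    · rw [List.foldr_cons, ih h, map_zero]

/-- A set of dimers that leaves a variable of integration uncovered does not contribute. -/
lemma exists_mem_of_berezin_ne_zero {l : List I} {a b : D → I} {K : Finset D}
    (h : berezin l ((∏ d ∈ K, pair (a d) (b d) : Subalgebra.center ℂ (Grassmann I)) :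
      Grassmann I) ≠ 0) {i : I} (hi : i ∈ l) : ∃ d ∈ K, i = a d ∨ i = b d := by
  classical
  by_contra! hne
  apply h
  rw [berezin, foldr_deriv_eq_zero hi, map_zero]
  clear h
  induction K using Finset.induction_on with
  | empty => simpa using deriv_one i
  | insert d K hd ih =>
    rw [Finset.prod_insert hd, coe_pair_mul, deriv_gen_mul_of_ne (hne d (by simp)).1,
      deriv_gen_mul_of_ne (hne d (by simp)).2,
      ih fun d' hd' => hne d' (Finset.mem_insert_of_mem hd')]
    simp

lemma pair_mul_pair_eq_zero {i j k l : I} (h : i = k ∨ i = l ∨ j = k ∨ j = l) :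
    pair i j * pair k l = 0 := by
  have key (i j k : I) : pair i j * pair i k = 0 := by
    refine Subtype.ext ?_
    change gen i * gen j * (gen i * gen k) = 0
    rw [gen_mul_gen i j, neg_mul, mul_assoc, ← mul_assoc (gen i), gen_mul_self]
    simp
  rcases h with rfl | rfl | rfl | rfl
  · exact key _ _ _
  · rw [pair_swap k, mul_smul_comm, key, smul_zero]
  · rw [pair_swap i, smul_mul_assoc, key, smul_zero]
  · rw [pair_swap i, pair_swap k, smul_mul_smul_comm, key, smul_zero]

/-- A set of dimers that covers a variable twice does not contribute. -/
lemma eq_of_berezin_ne_zero {l : List I} {a b : D → I} {K : Finset D}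
    (h : berezin l ((∏ d ∈ K, pair (a d) (b d) : Subalgebra.center ℂ (Grassmann I)) :
      Grassmann I) ≠ 0) {d d' : D} (hd : d ∈ K) (hd' : d' ∈ K)
    (hdd' : a d = a d' ∨ a d = b d' ∨ b d = a d' ∨ b d = b d') : d = d' := by
  classical
  by_contra hne
  apply h
  rw [← Finset.mul_prod_erase K _ hd, ← Finset.mul_prod_erase (K.erase d) _
    (Finset.mem_erase.2 ⟨Ne.symm hne, hd'⟩), ← mul_assoc, pair_mul_pair_eq_zero hdd', zero_mul]
  have (l : List I) : l.foldr (fun i g => deriv i g) (0 : Grassmann I) = 0 := by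
    induction l with
    | nil => rfl
    | cons i l ih => rw [List.foldr_cons, ih, map_zero]
  rw [berezin, ZeroMemClass.coe_zero, this, map_zero]

end Grassmann

namespace EmbeddedGraph

open Grassmann

variable {H : Type*}

lemma foldr_deriv_prod_pair {l : List H} (hl : l.Nodup)
    (y : Subalgebra.center ℂ (Grassmann (H × Fermion₂)))
    (hy : ∀ h ∈ l, ∀ k, deriv (h, k) (y : Grassmann (H × Fermion₂)) = 0) :
    (l.flatMap fun h => [(h, Fermion₂.psi), (h, .psiBar)]).foldr (fun i g => deriv i g)
        (((l.map fun h => pair (h, Fermion₂.psi) (h, .psiBar)).prod * y :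
          Subalgebra.center ℂ (Grassmann (H × Fermion₂))) : Grassmann (H × Fermion₂))
      = (-1 : ℂ) ^ l.length • (y : Grassmann (H × Fermion₂)) := by
  induction l generalizing y with
  | nil => simp
  | cons h l ih =>
    have hl' := List.nodup_cons.1 hl
    have e : ((h :: l).map fun h => pair (h, Fermion₂.psi) (h, .psiBar)).prod * y
        = (l.map fun h => pair (h, Fermion₂.psi) (h, .psiBar)).prod
          * (pair (h, .psi) (h, .psiBar) * y) := by
      rw [List.map_cons, List.prod_cons]; ring
    rw [e, List.flatMap_cons, List.foldr_append, ih hl'.2]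
    · have h1 := hy h (by simp) .psi
      have h2 := hy h (by simp) .psiBar
      simp only [List.foldr_cons, List.foldr_nil, map_smul, coe_pair_mul]
      rw [deriv_gen_mul_of_ne (by simp), deriv_gen_mul_self, h2, mul_zero, sub_zero, map_neg,
        deriv_gen_mul_self, h1, mul_zero, sub_zero, List.length_cons, pow_succ, mul_smul,
        neg_one_smul]
    · intro h' hh' k
      have hne : h' ≠ h := fun e => hl'.1 (e ▸ hh')
      rw [coe_pair_mul, deriv_gen_mul_of_ne (by simp [hne]), deriv_gen_mul_of_ne (by simp [hne]),
        hy h' (by simp [hh']) k]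
      simp

/-- The normalization of the Berezin integral. Each factor `ψ_h ψ̄_h` contributes `-1`, because
`∂_ψ ∂_ψ̄ (ψ ψ̄) = -1`, and the number of half-edges is even. -/
lemma berezin_complexMeasure_prod [Fintype H] (Γ : EmbeddedGraph H) :
    berezin (complexMeasure H) ((∏ h : H, pair (h, Fermion₂.psi) (h, .psiBar) :
      Subalgebra.center ℂ (Grassmann (H × Fermion₂))) : Grassmann (H × Fermion₂)) = 1 := by
  have := foldr_deriv_prod_pair (Finset.univ : Finset H).nodup_toList 1
    fun h _ k => by simpa using deriv_one (h, k)
  rw [mul_one, Finset.prod_map_toList, Finset.length_toList, Finset.card_univ,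
    Γ.even_card_halfEdges.neg_one_pow, one_smul] at this
  rw [berezin, complexMeasure, this]
  simp [constTerm]

end EmbeddedGraph

/-! ### Even sets of edges on the sphere are face boundaries -/

namespace EmbeddedGraph

variable {H : Type*} (Γ : EmbeddedGraph H)

lemma edge_eq_iff {h k : H} : Γ.edge k = Γ.edge h ↔ k = h ∨ k = Γ.opp h := by
  constructor
  · intro hk
    obtain ⟨i, hi⟩ : Γ.opp.SameCycle k h := Quotient.exact hk
    have h2 : Γ.opp ^ 2 = 1 := Equiv.ext fun h => Γ.opp_opp h
    rcases Int.even_or_odd' i with ⟨j, rfl | rfl⟩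
    · rw [zpow_mul, zpow_ofNat, h2, one_zpow] at hi
      exact Or.inl hi
    · rw [zpow_add, zpow_mul, zpow_ofNat, h2, one_zpow, one_mul, zpow_one] at hi
      exact Or.inr (by rw [← hi, Γ.opp_opp])
  · rintro (rfl | rfl)
    · rfl
    · exact Γ.edge_opp h

lemma vertex_rot (h : H) : Γ.vertex (Γ.rot h) = Γ.vertex h :=
  Quotient.sound (show Γ.rot.SameCycle (Γ.rot h) h from ⟨-1, by simp⟩)

lemma face_faceNext (h : H) : Γ.face (Γ.faceNext h) = Γ.face h :=
  Quotient.sound (show Γ.faceNext.SameCycle (Γ.faceNext h) h from ⟨-1, by simp⟩)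

lemma rot_faceNext (h : H) : Γ.rot (Γ.faceNext h) = Γ.opp h := by
  simp [faceNext]

/-- The face to the right of the half-edge `h` lies in the angle between `rot⁻¹ h` and `h`. -/
lemma face_opp (h : H) : Γ.face (Γ.opp h) = Γ.face (Γ.rot⁻¹ h) := by
  rw [← Γ.face_faceNext (Γ.opp h)]
  simp [faceNext, Γ.opp_opp]

lemma opp_source_target (o : Γ.Orientation) (e : Γ.Edge) : Γ.opp (o.target e) = o.source e :=
  Γ.opp_opp _

lemma edge_target (o : Γ.Orientation) (e : Γ.Edge) : Γ.edge (o.target e) = e :=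
  (Γ.edge_opp _).trans (o.edge_source e)

lemma eq_source_or_eq_target (o : Γ.Orientation) (h : H) :
    h = o.source (Γ.edge h) ∨ h = o.target (Γ.edge h) :=
  Γ.edge_eq_iff.1 (o.edge_source _).symm

@[to_additive]
lemma prod_halfEdges [Fintype H] {M : Type*} [CommMonoid M] (o : Γ.Orientation) (f : H → M) :
    ∏ h, f h = ∏ e, f (o.source e) * f (o.target e) := by
  classical
  rw [← Finset.prod_fiberwise Finset.univ Γ.edge f]
  refine Finset.prod_congr rfl fun e _ => ?_
  have : (Finset.univ.filter fun h => Γ.edge h = e) = {o.source e, o.target e} := by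
    ext h
    simp only [Finset.mem_filter, Finset.mem_univ, true_and, Finset.mem_insert,
      Finset.mem_singleton]
    constructor
    · rintro rfl
      exact Γ.eq_source_or_eq_target o h
    · rintro (rfl | rfl)
      · exact o.edge_source e
      · exact Γ.edge_target o e
  rw [this, Finset.prod_pair (a := o.source e) (b := o.target e) (Γ.opp_ne _).symm]

/-- A function that is constant around vertices and along edges of a connected graph is
constant. -/
lemma IsConnected.eq_of_rot_of_opp {Γ : EmbeddedGraph H} (hΓ : Γ.IsConnected) {α : Type*}
    (f : H → α) (hrot : ∀ h, f (Γ.rot h) = f h) (hopp : ∀ h, f (Γ.opp h) = f h) (h k : H) :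
    f h = f k := by
  have hv : ∀ a b : H, Γ.vertex a = Γ.vertex b → f a = f b := by
    intro a b hab
    obtain ⟨i, rfl⟩ : Γ.rot.SameCycle a b := Quotient.exact hab
    induction i using Int.induction_on with
    | zero => rfl
    | succ i ih =>
      rw [add_comm, zpow_add, zpow_one, Equiv.Perm.mul_apply, hrot, ih]
      exact Quotient.sound (show Γ.rot.SameCycle _ _ from ⟨i, rfl⟩)
    | pred i ih =>
      rw [ih (Quotient.sound (show Γ.rot.SameCycle _ _ from ⟨_, rfl⟩)), sub_eq_add_neg, add_comm,
        zpow_add, zpow_neg_one, Equiv.Perm.mul_apply, ← hrot (Γ.rot⁻¹ _)]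
      simp
  have key : ∀ u v, Γ.Joined Set.univ u v → ∀ a b, Γ.vertex a = u → Γ.vertex b = v →
      f a = f b := by
    intro u v huv
    induction huv with
    | refl => exact fun a b ha hb => hv a b (ha.trans hb.symm)
    | tail _ hbc ih =>
      obtain ⟨c, -, hc, hc'⟩ := hbc
      intro a b ha hb
      rw [ih a c ha hc, ← hopp, hv _ b (hc'.trans hb.symm)]
  exact key _ _ (hΓ.2 _ _) h k rfl rfl

section Homology

/-- The sum over `ℤ/2` of the boundaries of faces, as a set of edges. -/
def faceBoundary (o : Γ.Orientation) : (Γ.Face → ZMod 2) →ₗ[ZMod 2] (Γ.Edge → ZMod 2) where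
  toFun c e := c (Γ.face (o.source e)) + c (Γ.face (o.target e))
  map_add' c d := by ext e; simp only [Pi.add_apply]; ring
  map_smul' r c := by ext e; simp only [Pi.smul_apply, smul_eq_mul, RingHom.id_apply]; ring

lemma faceBoundary_edge (o : Γ.Orientation) (c : Γ.Face → ZMod 2) (h : H) :
    Γ.faceBoundary o c (Γ.edge h) = c (Γ.face h) + c (Γ.face (Γ.opp h)) := by
  change c (Γ.face (o.source (Γ.edge h))) + c (Γ.face (o.target (Γ.edge h))) = _
  rcases Γ.eq_source_or_eq_target o h with h1 | h1
  · conv_rhs => rw [h1]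
    rfl
  · conv_rhs => rw [h1, Γ.opp_source_target]
    rw [add_comm]

variable [Fintype H]

/-- The incidence matrix over `ℤ/2` of vertices and edges. A loop has entry zero. -/
def incidence (o : Γ.Orientation) : Matrix Γ.Vertex Γ.Edge (ZMod 2) := fun v e =>
  (if Γ.vertex (o.source e) = v then 1 else 0) + (if Γ.vertex (o.target e) = v then 1 else 0)

lemma incidence_mulVec (o : Γ.Orientation) (s : Γ.Edge → ZMod 2) (v : Γ.Vertex) :
    (Γ.incidence o).mulVec s v = ∑ h, if Γ.vertex h = v then s (Γ.edge h) else 0 := by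
  rw [Γ.sum_halfEdges o, Matrix.mulVec, dotProduct]
  refine Finset.sum_congr rfl fun e _ => ?_
  simp only [incidence, o.edge_source, Γ.edge_target]
  rw [add_mul, ite_mul, ite_mul, one_mul, zero_mul]

lemma incidence_col_edge (o : Γ.Orientation) (h : H) (v : Γ.Vertex) :
    (Γ.incidence o).col (Γ.edge h) v
      = (if Γ.vertex h = v then 1 else 0) + (if Γ.vertex (Γ.opp h) = v then 1 else 0) := by
  simp only [Matrix.col_apply, incidence]
  rcases Γ.eq_source_or_eq_target o h with h1 | h1
  · conv_rhs => rw [h1]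
    rfl
  · conv_rhs => rw [h1, Γ.opp_source_target]
    rw [add_comm]

lemma incidence_transpose_mulVec (o : Γ.Orientation) (σ : Γ.Vertex → ZMod 2) (e : Γ.Edge) :
    (Γ.incidence o).transpose.mulVec σ e
      = σ (Γ.vertex (o.source e)) + σ (Γ.vertex (o.target e)) := by
  simp [Matrix.mulVec, dotProduct, incidence, add_mul, Finset.sum_add_distrib]

/-- On the sphere every even set of edges is a sum over `ℤ/2` of face boundaries: boundaries are
even, and by Euler's formula the two spaces have the same dimension. -/
lemma IsPlanar.exists_faceBoundary {Γ : EmbeddedGraph H} (hΓ : Γ.IsPlanar) (o : Γ.Orientation)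
    (s : Γ.Edge → ZMod 2)
    (hs : ∀ v, ∑ h, (if Γ.vertex h = v then s (Γ.edge h) else 0) = 0) :
    ∃ c : Γ.Face → ZMod 2, ∀ h, s (Γ.edge h) = c (Γ.face h) + c (Γ.face (Γ.opp h)) := by
  classical
  obtain ⟨hconn, heuler⟩ := hΓ
  obtain ⟨v₀⟩ := hconn.1
  obtain ⟨h₀, rfl⟩ := Quotient.exists_rep v₀
  let _ : Fintype Γ.Face := Fintype.ofFinite _
  -- The coboundary from vertices to edges has the constants as its kernel.
  have hT : LinearMap.ker (Γ.incidence o).transpose.mulVecLin = Submodule.span (ZMod 2) {1} := by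
    ext σ
    rw [LinearMap.mem_ker, Submodule.mem_span_singleton, Matrix.mulVecLin_apply]
    constructor
    · intro hσ
      have hopp (h : H) : σ (Γ.vertex (Γ.opp h)) = σ (Γ.vertex h) := by
        have := congrFun hσ (Γ.edge h)
        rw [incidence_transpose_mulVec] at this
        have := CharTwo.add_eq_zero.1 this
        rcases Γ.eq_source_or_eq_target o h with h1 | h1
        · rw [h1]; exact this.symm
        · rw [h1, Γ.opp_source_target]; exact this
      refine ⟨σ (Γ.vertex h₀), funext fun v => ?_⟩
      obtain ⟨h, rfl⟩ := Quotient.exists_rep v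
      have := hconn.eq_of_rot_of_opp (fun h => σ (Γ.vertex h))
        (fun h => congrArg σ (Γ.vertex_rot h)) hopp h₀ h
      exact (mul_one _).trans this
    · rintro ⟨a, rfl⟩
      ext e
      rw [incidence_transpose_mulVec]
      simpa using CharTwo.add_self_eq_zero a
  -- So does the boundary map from faces to edges, as the dual graph is connected.
  have hD : LinearMap.ker (Γ.faceBoundary o) = Submodule.span (ZMod 2) {1} := by
    ext c
    rw [LinearMap.mem_ker, Submodule.mem_span_singleton]
    constructor
    · intro hc
      have hopp (h : H) : c (Γ.face (Γ.opp h)) = c (Γ.face h) := by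
        have := congrFun hc (Γ.edge h)
        rw [faceBoundary_edge] at this
        exact (CharTwo.add_eq_zero.1 this).symm
      refine ⟨c (Γ.face h₀), funext fun f => ?_⟩
      obtain ⟨h, rfl⟩ := Quotient.exists_rep f
      have := hconn.eq_of_rot_of_opp (fun h => c (Γ.face h)) (fun h => by
        have := hopp (Γ.rot h)
        rw [face_opp, ← Equiv.Perm.mul_apply, inv_mul_cancel, Equiv.Perm.one_apply] at this
        exact this.symm) hopp h₀ h
      exact (mul_one _).trans this
    · rintro ⟨a, rfl⟩
      ext e
      exact CharTwo.add_self_eq_zero _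
  -- At a vertex every face is counted once for each of the two half-edges of an angle.
  have hle : LinearMap.range (Γ.faceBoundary o) ≤ LinearMap.ker (Γ.incidence o).mulVecLin := by
    rintro _ ⟨c, rfl⟩
    rw [LinearMap.mem_ker, Matrix.mulVecLin_apply]
    ext v
    rw [incidence_mulVec]
    simp only [faceBoundary_edge, face_opp]
    have h1 : ∑ h, (if Γ.vertex h = v then c (Γ.face (Γ.rot⁻¹ h)) else 0)
        = ∑ h, if Γ.vertex h = v then c (Γ.face h) else 0 := by
      rw [← Equiv.sum_comp Γ.rot]
      simp [vertex_rot]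
    have h2 : ∀ h, (if Γ.vertex h = v then c (Γ.face h) + c (Γ.face (Γ.rot⁻¹ h)) else 0)
        = (if Γ.vertex h = v then c (Γ.face h) else 0)
          + (if Γ.vertex h = v then c (Γ.face (Γ.rot⁻¹ h)) else 0) := by
      intro h; split_ifs <;> simp
    rw [Finset.sum_congr rfl fun h _ => h2 h, Finset.sum_add_distrib, h1]
    exact CharTwo.add_self_eq_zero _
  have hne1 : (1 : Γ.Vertex → ZMod 2) ≠ 0 := fun h => one_ne_zero (congrFun h (Γ.vertex h₀))
  have hne2 : (1 : Γ.Face → ZMod 2) ≠ 0 := fun h => one_ne_zero (congrFun h (Γ.face h₀))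
  have e1 := LinearMap.finrank_range_add_finrank_ker (Γ.incidence o).transpose.mulVecLin
  have e2 := LinearMap.finrank_range_add_finrank_ker (Γ.faceBoundary o)
  have e3 := LinearMap.finrank_range_add_finrank_ker (Γ.incidence o).mulVecLin
  have e4 : Module.finrank (ZMod 2) (LinearMap.range (Γ.incidence o).transpose.mulVecLin)
      = Module.finrank (ZMod 2) (LinearMap.range (Γ.incidence o).mulVecLin) :=
    Matrix.rank_transpose (Γ.incidence o)
  rw [hT, finrank_span_singleton hne1, Module.finrank_fintype_fun_eq_card] at e1
  rw [hD, finrank_span_singleton hne2, Module.finrank_fintype_fun_eq_card] at e2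
  rw [Module.finrank_fintype_fun_eq_card] at e3
  simp only [Nat.card_eq_fintype_card] at heuler
  have heq := Submodule.eq_of_le_of_finrank_eq hle (by omega)
  have hsmem : s ∈ LinearMap.ker (Γ.incidence o).mulVecLin := by
    rw [LinearMap.mem_ker, Matrix.mulVecLin_apply]
    ext v
    rw [incidence_mulVec, hs]; rfl
  rw [← heq] at hsmem
  obtain ⟨c, rfl⟩ := hsmem
  exact ⟨c, fun h => Γ.faceBoundary_edge o c h⟩

/-- In a bridgeless planar graph the two sides of an edge belong to different faces: the edge lies
on a cycle, and this cycle is the boundary of a set of faces. -/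
lemma IsPlanar.face_opp_ne {Γ : EmbeddedGraph H} (hΓ : Γ.IsPlanar) (hb : Γ.IsBridgeless)
    (o : Γ.Orientation) (h : H) : Γ.face (Γ.opp h) ≠ Γ.face h := by
  classical
  -- A path that avoids the edge, as a chain with boundary its two endpoints.
  have path : ∀ u v, Γ.Joined {Γ.edge h}ᶜ u v → ∃ s : Γ.Edge → ZMod 2, s (Γ.edge h) = 0 ∧
      ∀ w, ∑ k, (if Γ.vertex k = w then s (Γ.edge k) else 0)
        = (if u = w then 1 else 0) + (if v = w then 1 else 0) := by
    intro u v huv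
    induction huv with
    | refl => exact ⟨0, rfl, fun w => by simpa using (CharTwo.add_self_eq_zero _).symm⟩
    | @tail b c _ hbc ih =>
      obtain ⟨s, hs, hsum⟩ := ih
      obtain ⟨k, hk, rfl, rfl⟩ := hbc
      refine ⟨s + Pi.single (Γ.edge k) 1, ?_, fun w => ?_⟩
      · rw [Pi.add_apply, hs, Pi.single_eq_of_ne (Ne.symm hk), add_zero]
      · have := Γ.incidence_mulVec o (s + Pi.single (Γ.edge k) 1) w
        rw [← this, Matrix.mulVec_add, Pi.add_apply, incidence_mulVec, hsum,
          Matrix.mulVec_single_one]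
        rw [incidence_col_edge, add_assoc, ← add_assoc (if Γ.vertex k = w then (1 : ZMod 2) else 0),
          CharTwo.add_self_eq_zero, zero_add]
  obtain ⟨s, hs, hsum⟩ := path _ _ (hb (Γ.edge h) _ _ (hΓ.1.2 (Γ.vertex h) (Γ.vertex (Γ.opp h))))
  obtain ⟨c, hc⟩ := hΓ.exists_faceBoundary o (s + Pi.single (Γ.edge h) 1) (fun w => by
    rw [← Γ.incidence_mulVec o, Matrix.mulVec_add, Pi.add_apply, incidence_mulVec, hsum,
          Matrix.mulVec_single_one]
    rw [incidence_col_edge, CharTwo.add_self_eq_zero])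
  intro hf
  have := hc h
  rw [hf, CharTwo.add_self_eq_zero, Pi.add_apply, hs, Pi.single_eq_same] at this
  simp at this

end Homology

end EmbeddedGraph

/-! ### Trivalent vertices, boundary walks of faces, signs of permutations -/

namespace EmbeddedGraph

variable {H : Type*} {Γ : EmbeddedGraph H}

section Trivalent

variable [Fintype H]

lemma IsTrivalent.minimalPeriod_rot (hΓ : Γ.IsTrivalent) (h : H) :
    Function.minimalPeriod Γ.rot h = 3 := by
  classical
  rw [← hΓ (Γ.vertex h), show (Γ.rot : H → H) = (Γ.rot • ·) from rfl,
    MulAction.minimalPeriod_eq_card, ← Nat.card_eq_fintype_card]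
  refine Nat.card_congr (Equiv.subtypeEquivRight fun k => ?_)
  rw [MulAction.mem_orbit_iff]
  constructor
  · rintro ⟨⟨_, i, rfl⟩, rfl⟩
    exact (Quotient.sound (show Γ.rot.SameCycle _ _ from ⟨i, rfl⟩)).symm
  · intro hk
    obtain ⟨i, hi⟩ : Γ.rot.SameCycle h k := Quotient.exact hk.symm
    exact ⟨⟨_, i, rfl⟩, hi⟩

lemma IsTrivalent.rot_rot_rot (hΓ : Γ.IsTrivalent) (h : H) : Γ.rot (Γ.rot (Γ.rot h)) = h := by
  have := Function.isPeriodicPt_minimalPeriod Γ.rot h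
  rwa [hΓ.minimalPeriod_rot] at this

lemma IsTrivalent.rot_ne (hΓ : Γ.IsTrivalent) (h : H) : Γ.rot h ≠ h := by
  intro e
  have := Function.minimalPeriod_eq_one_iff_isFixedPt.2 e
  rw [hΓ.minimalPeriod_rot] at this
  omega

lemma IsTrivalent.rot_rot_ne (hΓ : Γ.IsTrivalent) (h : H) : Γ.rot (Γ.rot h) ≠ h := by
  intro e
  have h2 : Function.IsPeriodicPt Γ.rot 2 h := e
  have := h2.minimalPeriod_dvd
  rw [hΓ.minimalPeriod_rot] at this
  omega

lemma IsTrivalent.sum_vertex (hΓ : Γ.IsTrivalent) {M : Type*} [AddCommMonoid M] (f : H → M)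
    (h : H) : ∑ k, (if Γ.vertex k = Γ.vertex h then f k else 0)
      = f h + f (Γ.rot h) + f (Γ.rot (Γ.rot h)) := by
  classical
  have hne := hΓ.rot_ne
  have hne2 := hΓ.rot_rot_ne h
  have : (Finset.univ.filter fun k => Γ.vertex k = Γ.vertex h)
      = {h, Γ.rot h, Γ.rot (Γ.rot h)} := by
    symm
    apply Finset.eq_of_subset_of_card_le
    · intro k
      simp only [Finset.mem_insert, Finset.mem_singleton, Finset.mem_filter, Finset.mem_univ,
        true_and]
      rintro (rfl | rfl | rfl) <;> simp [vertex_rot]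
    · rw [Finset.card_eq_three.2 ⟨h, Γ.rot h, Γ.rot (Γ.rot h), (hne h).symm, hne2.symm,
        (hne _).symm, rfl⟩, ← hΓ (Γ.vertex h), Nat.card_eq_fintype_card, Fintype.card_subtype]
  rw [← Finset.sum_filter, this, Finset.sum_insert, Finset.sum_pair, add_assoc]
  · exact (hne _).symm
  · simp [(hne h).symm, hne2.symm]

end Trivalent

/-- A set of edges with an even number of half-edges at every vertex, encoded by the indicator
function of its half-edges. -/
structure IsEven (Γ : EmbeddedGraph H) (x : H → ZMod 2) : Prop where
  opp : ∀ h, x (Γ.opp h) = x h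
  rot : ∀ h, x h + x (Γ.rot h) + x (Γ.rot (Γ.rot h)) = 0

lemma IsTrivalent.single_add_rot [Fintype H] (hΓ : Γ.IsTrivalent) [DecidableEq H] (a h : H) :
    (Pi.single a 1 : H → ZMod 2) h + (Pi.single a 1 : H → ZMod 2) (Γ.rot h)
        + (Pi.single a 1 : H → ZMod 2) (Γ.rot (Γ.rot h))
      = if Γ.vertex a = Γ.vertex h then 1 else 0 := by
  rw [← hΓ.sum_vertex, Finset.sum_eq_single a]
  · simp
  · intro b _ hb
    simp [hb]
  · simp

section Faces

variable (Γ)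

lemma face_iterate (h : H) (i : ℕ) : Γ.face (Γ.faceNext^[i] h) = Γ.face h := by
  induction i with
  | zero => rfl
  | succ i ih => rw [Function.iterate_succ_apply', face_faceNext, ih]

lemma iterate_faceNext_injOn (h : H) :
    Set.InjOn (fun i => Γ.faceNext^[i] h)
      (Finset.range (Function.minimalPeriod Γ.faceNext h) : Set ℕ) := by
  intro i hi j hj hij
  rw [Finset.coe_range] at hi hj
  exact Function.iterate_injOn_Iio_minimalPeriod hi hj hij

variable [Fintype H]

/-- The boundary walk of a face meets each of its half-edges exactly once. -/
@[to_additive]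
lemma prod_iterate_faceNext {M : Type*} [CommMonoid M] (f : H → M) (h : H)
    [DecidablePred fun k => Γ.face k = Γ.face h] :
    ∏ i ∈ Finset.range (Function.minimalPeriod Γ.faceNext h), f (Γ.faceNext^[i] h)
      = ∏ k with Γ.face k = Γ.face h, f k := by
  classical
  have hpos : 0 < Function.minimalPeriod Γ.faceNext h :=
    Function.minimalPeriod_pos_of_mem_periodicPts
      ((Function.Injective.mem_periodicPts Γ.faceNext.injective) h)
  have : (Finset.univ.filter fun k => Γ.face k = Γ.face h)
      = (Finset.range (Function.minimalPeriod Γ.faceNext h)).image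
        fun i => Γ.faceNext^[i] h := by
    ext k
    simp only [Finset.mem_filter, Finset.mem_univ, true_and, Finset.mem_image, Finset.mem_range]
    constructor
    · intro hk
      obtain ⟨i, -, hi⟩ := (Quotient.exact hk.symm : Γ.faceNext.SameCycle h k).exists_pow_eq'
      refine ⟨i % Function.minimalPeriod Γ.faceNext h, Nat.mod_lt _ hpos, ?_⟩
      rw [Function.iterate_mod_minimalPeriod_eq, Equiv.Perm.iterate_eq_pow, hi]
    · rintro ⟨i, -, rfl⟩
      exact Γ.face_iterate h i
  rw [this, Finset.prod_image (Γ.iterate_faceNext_injOn h)]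

end Faces

end EmbeddedGraph

/-- Whether two orderings of the same distinct anticommuting elements have equal or opposite
products is independent of the ring: the sign is that of the permutation. -/
lemma List.Perm.exists_sign {I : Type*} {l l' : List I} (hp : l.Perm l') (hl : l.Nodup) :
    ∃ ε : ℤˣ, ∀ (R : Type u) [Ring R] (c : I → R), (∀ i j, i ≠ j → c i * c j = -(c j * c i)) →
      (l.map c).prod = (ε : ℤ) • (l'.map c).prod := by
  induction hp with
  | nil => exact ⟨1, fun R _ c _ => by simp⟩
  | cons i _ ih =>
    obtain ⟨ε, hε⟩ := ih (List.nodup_cons.1 hl).2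
    exact ⟨ε, fun R _ c hc => by
      rw [List.map_cons, List.prod_cons, hε R c hc, List.map_cons, List.prod_cons, mul_smul_comm]⟩
  | swap i j l =>
    refine ⟨-1, fun R _ c hc => ?_⟩
    have hij : j ≠ i := fun e => (List.nodup_cons.1 hl).1 (by simp [e])
    simp only [List.map_cons, List.prod_cons, ← mul_assoc]
    rw [hc j i hij]
    simp
  | trans h1 _ ih1 ih2 =>
    obtain ⟨ε, hε⟩ := ih1 hl
    obtain ⟨δ, hδ⟩ := ih2 (h1.nodup_iff.1 hl)
    exact ⟨ε * δ, fun R _ c hc => by rw [hε R c hc, hδ R c hc, smul_smul, Units.val_mul]⟩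

/-! ### Products of angles and of edges in a Clifford algebra -/

/-- A family of anticommuting square roots of one: the generators of a Clifford algebra. -/
structure IsCliffordFamily {I R : Type*} [Ring R] (c : I → R) : Prop where
  anticomm : ∀ i j, i ≠ j → c i * c j = -(c j * c i)
  sq : ∀ i, c i * c i = 1

namespace IsCliffordFamily

variable {I R : Type*} [Ring R] {c : I → R}

lemma sq_mul (hc : IsCliffordFamily c) (i : I) (y : R) : c i * (c i * y) = y := by
  rw [← mul_assoc, hc.sq, one_mul]

lemma commute_pair (hc : IsCliffordFamily c) {i j k : I} (hi : i ≠ k) (hj : j ≠ k) :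
    Commute (c i * c j) (c k) := by
  rw [Commute, SemiconjBy, mul_assoc, hc.anticomm j k hj, mul_neg, ← mul_assoc,
    hc.anticomm i k hi, neg_mul, neg_neg, mul_assoc]

lemma commute_pair_pair (hc : IsCliffordFamily c) {i j k l : I} (hik : i ≠ k)
    (hjk : j ≠ k) (hil : i ≠ l) (hjl : j ≠ l) :
    Commute (c i * c j) (c k * c l) :=
  (hc.commute_pair hik hjk).mul_right (hc.commute_pair hil hjl)

lemma pair_mul_self (hc : IsCliffordFamily c) {i j : I} (h : i ≠ j) :
    c i * c j * (c i * c j) = -1 := by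
  rw [mul_assoc, hc.anticomm i j h, mul_neg, mul_neg, hc.sq_mul, hc.sq]

/-- Regrouping a cyclic product of anticommuting elements `p₁ q₀ p₂ q₁ ⋯ p₀ qₙ₋₁` into
`q₀ p₀ q₁ p₁ ⋯ qₙ₋₁ pₙ₋₁` changes its sign. -/
lemma prod_cyclic (hc : IsCliffordFamily c) (p q : ℕ → I) (n : ℕ)
    (hpq : ∀ i j, p i ≠ q j) (hn : p (n + 1) = p 0)
    (hp : ∀ i < n, p (i + 1) ≠ p 0) :
    ((List.range (n + 1)).map fun i => c (p (i + 1)) * c (q i)).prod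
      = -((List.range (n + 1)).map fun i => c (q i) * c (p i)).prod := by
  have h1 (m : ℕ) : c (p 0) * ((List.range m).map fun i => c (p (i + 1)) * c (q i)).prod
      = ((List.range m).map fun i => c (q i) * c (p i)).prod * c (p m) := by
    induction m with
    | zero => simp
    | succ m ih =>
      rw [List.prod_range_succ, ← mul_assoc, ih, List.prod_range_succ,
        hc.anticomm _ _ (hpq (m + 1) m), mul_neg, ← mul_assoc, mul_assoc _ (c (p m)),
        hc.anticomm _ _ (hpq m m)]
      simp only [mul_neg, neg_mul, neg_neg, mul_assoc]
  have h2 := h1 (n + 1)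
  rw [hn] at h2
  have h3 : Commute (((List.range n).map fun i => c (q (i + 1)) * c (p (i + 1))).prod)
      (c (p 0)) := by
    refine (Commute.list_prod_right _ _ fun y hy => ?_).symm
    obtain ⟨i, hi, rfl⟩ := List.mem_map.1 hy
    exact (hc.commute_pair (hpq 0 (i + 1)).symm (hp i (List.mem_range.1 hi))).symm
  have h4 : ((List.range (n + 1)).map fun i => c (q i) * c (p i)).prod
      = c (q 0) * c (p 0) * ((List.range n).map fun i => c (q (i + 1)) * c (p (i + 1))).prod :=
    List.prod_range_succ' ..
  rw [← hc.sq_mul (p 0) (List.prod _), h2, h4, mul_assoc _ _ (c (p 0)), h3.eq, mul_assoc (c (q 0)),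
    hc.sq_mul, ← mul_assoc, hc.anticomm _ _ (hpq 0 0), neg_mul]

end IsCliffordFamily

/-- The indicator function over `ℤ/2` of a pair of elements. -/
def pairInd {H : Type*} [DecidableEq H] (a b : H) : H → ZMod 2 := Pi.single a 1 + Pi.single b 1

/-- The sign `-1` for the nonzero element of `ℤ/2`. -/
def boolSign (z : ZMod 2) : ℤ := if z = 1 then -1 else 1

namespace EmbeddedGraph

variable {H : Type*} [Fintype H] {Γ : EmbeddedGraph H} {R : Type*} [Ring R] (c : H → R)

variable (Γ) in
/-- The contribution of the angle `(h, rot h)` to `angleProd`: it counts if both its half-edges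
belong to the edges `x`. -/
def angleFactor (x : H → ZMod 2) (h : H) : R :=
  if x h = 1 ∧ x (Γ.rot h) = 1 then c h * c (Γ.rot h) else 1

variable (Γ) in
/-- The product of the pairs of half-edges of `x` that meet at a vertex. If `x` is even at the
vertices, the factors commute, so the order of the list is irrelevant. -/
def angleProd (x : H → ZMod 2) : R :=
  ((Finset.univ : Finset H).toList.map (Γ.angleFactor c x)).prod

/-- The product of the edges of `x`, as pairs of their target and source half-edges. The factors
commute. -/
def edgeProd (o : Γ.Orientation) (x : H → ZMod 2) : R :=
  ((Finset.univ : Finset Γ.Edge).toList.map fun e =>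
    if x (o.source e) = 1 then c (o.target e) * c (o.source e) else 1).prod

variable {c}

lemma commute_angleFactor (hc : IsCliffordFamily c) (hΓ : Γ.IsTrivalent) {x : H → ZMod 2}
    (hx : ∀ h, x h + x (Γ.rot h) + x (Γ.rot (Γ.rot h)) = 0) (h k : H) :
    Commute (Γ.angleFactor c x h) (Γ.angleFactor c x k) := by
  have h3 := hΓ.rot_rot_rot
  have key : ∀ h, Commute (Γ.angleFactor c x h) (Γ.angleFactor c x (Γ.rot h)) := by
    intro h
    rw [angleFactor, angleFactor]
    split_ifs with h1 h2
    · exfalso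
      have := hx h
      rw [h1.1, h1.2, h2.2] at this
      exact absurd this (by decide)
    · exact Commute.one_right _
    · exact Commute.one_left _
    · exact Commute.one_left _
  by_cases hhk : k = h
  · rw [hhk]
  by_cases hk : k = Γ.rot h
  · rw [hk]; exact key h
  by_cases hh : h = Γ.rot k
  · rw [hh]; exact (key k).symm
  rw [angleFactor, angleFactor]
  split_ifs
  · exact hc.commute_pair_pair (Ne.symm hhk) (Ne.symm hk) hh
      (fun e => hhk (Γ.rot.injective e).symm)
  · exact Commute.one_right _
  · exact Commute.one_left _
  · exact Commute.one_left _

/-- Multiplying by an angle adds it modulo two. At its vertex this is the multiplication table of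
the quaternion group. -/
lemma angleProd_mul [DecidableEq H] (hc : IsCliffordFamily c) (hΓ : Γ.IsTrivalent)
    {x : H → ZMod 2} (hx : ∀ h, x h + x (Γ.rot h) + x (Γ.rot (Γ.rot h)) = 0) (a : H) :
    Γ.angleProd c x * (c a * c (Γ.rot a))
      = boolSign (x a) • Γ.angleProd c (x + pairInd a (Γ.rot a)) := by
  classical
  have hab : a ≠ Γ.rot a := (hΓ.rot_ne a).symm
  have hbd : Γ.rot a ≠ Γ.rot (Γ.rot a) := (hΓ.rot_ne _).symm
  have had : a ≠ Γ.rot (Γ.rot a) := (hΓ.rot_rot_ne a).symm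
  have hda := hΓ.rot_rot_rot a
  have hx' : ∀ h, (x + pairInd a (Γ.rot a)) h
      + (x + pairInd a (Γ.rot a)) (Γ.rot h)
      + (x + pairInd a (Γ.rot a)) (Γ.rot (Γ.rot h)) = 0 := by
    intro h
    have e1 := hΓ.single_add_rot a h
    have e2 := hΓ.single_add_rot (Γ.rot a) h
    rw [vertex_rot] at e2
    simp only [pairInd, Pi.add_apply]
    linear_combination hx h + e1 + e2 + CharTwo.add_self_eq_zero
      (if Γ.vertex a = Γ.vertex h then (1 : ZMod 2) else 0)
  set L := (Finset.univ \ {a, Γ.rot a, Γ.rot (Γ.rot a)} : Finset H).toList with hL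
  have hperm : (Finset.univ : Finset H).toList.Perm (a :: Γ.rot a :: Γ.rot (Γ.rot a) :: L) := by
    refine (List.perm_ext_iff_of_nodup (Finset.nodup_toList _) ?_).2 fun h => ?_
    · simp [hL, hab, hbd, had, Finset.nodup_toList]
    · simp only [Finset.mem_toList, Finset.mem_univ, List.mem_cons, hL, Finset.mem_sdiff,
        Finset.mem_insert, Finset.mem_singleton, true_and, true_iff]
      tauto
  -- Only the factors of the three angles at the vertex of `a` change.
  have hprod : ∀ y : H → ZMod 2, (∀ h, y h + y (Γ.rot h) + y (Γ.rot (Γ.rot h)) = 0) →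
      Γ.angleProd c y = Γ.angleFactor c y a * Γ.angleFactor c y (Γ.rot a)
        * Γ.angleFactor c y (Γ.rot (Γ.rot a)) * (L.map (Γ.angleFactor c y)).prod := by
    intro y hy
    rw [angleProd, (hperm.map (Γ.angleFactor c y)).prod_eq' ?_]
    · simp only [List.map_cons, List.prod_cons, mul_assoc]
    · rw [List.pairwise_map]
      exact List.pairwise_of_forall fun h k => commute_angleFactor hc hΓ hy h k
  have hLmem : ∀ h ∈ L, h ≠ a ∧ h ≠ Γ.rot a ∧ Γ.rot h ≠ a ∧ Γ.rot h ≠ Γ.rot a := by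
    intro h hh
    simp only [hL, Finset.mem_toList, Finset.mem_sdiff, Finset.mem_univ, Finset.mem_insert,
      Finset.mem_singleton, true_and, not_or] at hh
    refine ⟨hh.1, hh.2.1, fun e => hh.2.2 ?_, fun e => hh.1 (Γ.rot.injective e)⟩
    rw [← e, hΓ.rot_rot_rot]
  have hLeq : (L.map (Γ.angleFactor c (x + pairInd a (Γ.rot a)))).prod
      = (L.map (Γ.angleFactor c x)).prod := by
    congr 1
    refine List.map_congr_left fun h hh => ?_
    obtain ⟨h1, h2, h3, h4⟩ := hLmem h hh
    simp [angleFactor, pairInd, h1, h2, h3, h4]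
  have hcomm : Commute (L.map (Γ.angleFactor c x)).prod (c a * c (Γ.rot a)) := by
    refine (Commute.list_prod_right _ _ fun y hy => ?_).symm
    obtain ⟨h, hh, rfl⟩ := List.mem_map.1 hy
    obtain ⟨h1, h2, h3, h4⟩ := hLmem h hh
    rw [angleFactor]
    split_ifs
    · exact hc.commute_pair_pair h1.symm h2.symm h3.symm h4.symm
    · exact Commute.one_right _
  rw [hprod x hx, hprod _ hx', hLeq, mul_assoc _ _ (c a * c (Γ.rot a)), hcomm.eq, ← mul_assoc,
    ← smul_mul_assoc]
  congr 1
  simp only [angleFactor, hda]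
  have e1 : (x + pairInd a (Γ.rot a)) a = x a + 1 := by simp [pairInd, hab]
  have e2 : (x + pairInd a (Γ.rot a)) (Γ.rot a) = x (Γ.rot a) + 1 := by
    simp [pairInd, hab.symm]
  have e3 : (x + pairInd a (Γ.rot a)) (Γ.rot (Γ.rot a))
      = x (Γ.rot (Γ.rot a)) := by simp [pairInd, had.symm, hbd.symm]
  rw [e1, e2, e3]
  have hs := hx a
  set b := Γ.rot a
  set d := Γ.rot b
  have z01 : ∀ z : ZMod 2, z = 0 ∨ z = 1 := by decide
  have h11 : (1 : ZMod 2) + 1 = 0 := by decide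
  have h10 : (0 : ZMod 2) ≠ 1 := by decide
  rcases z01 (x a) with ha | ha <;> rcases z01 (x b) with hb | hb
  · have hd : x d = 0 := by rw [ha, hb] at hs; simpa using hs
    simp [ha, hb, hd, boolSign]
  · have hd : x d = 1 := by rw [ha, hb] at hs; revert hs; generalize x d = z; revert z; decide
    simp only [ha, hb, hd, boolSign, h11, h10, zero_add, and_false, false_and, and_self, if_true,
      if_false, one_mul, mul_one, one_smul]
    -- `(b d)(a b) = d a`
    rw [hc.anticomm b d hbd, neg_mul, mul_assoc, ← mul_assoc (c b), ← neg_eq_iff_eq_neg.2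
      (hc.anticomm a b hab), neg_mul, mul_assoc, hc.sq, mul_one, mul_neg, neg_neg]
  · have hd : x d = 1 := by rw [ha, hb] at hs; revert hs; generalize x d = z; revert z; decide
    simp only [ha, hb, hd, boolSign, h11, h10, zero_add, and_false, false_and, and_self, if_true,
      if_false, one_mul, mul_one]
    -- `(d a)(a b) = -(b d)`
    rw [mul_assoc, hc.sq_mul, hc.anticomm d b hbd.symm, neg_one_smul]
  · have hd : x d = 0 := by rw [ha, hb] at hs; revert hs; generalize x d = z; revert z; decide
    simp only [ha, hb, hd, boolSign, h11, h10, and_false, false_and, and_self, if_true,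
      if_false, mul_one]
    rw [hc.pair_mul_self hab, neg_one_smul]

/-- Multiplying by an edge adds it modulo two. -/
lemma edgeProd_mul [DecidableEq H] (hc : IsCliffordFamily c) (o : Γ.Orientation)
    (x : H → ZMod 2) (e : Γ.Edge) :
    edgeProd c o x * (c (o.target e) * c (o.source e))
      = boolSign (x (o.source e)) •
        edgeProd c o (x + pairInd (o.source e) (o.target e)) := by
  classical
  have hne : ∀ e', e' ≠ e → o.source e' ≠ o.source e ∧ o.source e' ≠ o.target e ∧
      o.target e' ≠ o.source e ∧ o.target e' ≠ o.target e := by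
    intro e' he'
    refine ⟨fun h => he' ?_, fun h => he' ?_, fun h => he' ?_, fun h => he' ?_⟩
    · rw [← o.edge_source e', h, o.edge_source]
    · rw [← o.edge_source e', h, edge_target]
    · rw [← Γ.edge_target o e', h, o.edge_source]
    · rw [← Γ.edge_target o e', h, edge_target]
  set L := (Finset.univ.erase e : Finset Γ.Edge).toList with hL
  have hperm : (Finset.univ : Finset Γ.Edge).toList.Perm (e :: L) := by
    refine (List.perm_ext_iff_of_nodup (Finset.nodup_toList _) ?_).2 fun h => ?_
    · simp [hL, Finset.nodup_toList]
    · simp only [Finset.mem_toList, Finset.mem_univ, List.mem_cons, hL, Finset.mem_erase,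
        and_true, true_iff]
      tauto
  have hcomm : ∀ (e₁ e₂ : Γ.Edge), e₁ ≠ e₂ →
      Commute (c (o.target e₁) * c (o.source e₁)) (c (o.target e₂) * c (o.source e₂)) := by
    intro e₁ e₂ h12
    refine hc.commute_pair_pair ?_ ?_ ?_ ?_
    · intro h; exact h12 (by rw [← Γ.edge_target o e₁, h, edge_target])
    · intro h; exact h12 (by rw [← o.edge_source e₁, h, edge_target])
    · intro h; exact h12 (by rw [← Γ.edge_target o e₁, h, o.edge_source])
    · intro h; exact h12 (by rw [← o.edge_source e₁, h, o.edge_source])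
  have hprod : ∀ y : H → ZMod 2, edgeProd c o y
      = (if y (o.source e) = 1 then c (o.target e) * c (o.source e) else 1)
        * (L.map fun e =>
            if y (o.source e) = 1 then c (o.target e) * c (o.source e) else 1).prod := by
    intro y
    rw [edgeProd, (hperm.map _).prod_eq' ?_, List.map_cons, List.prod_cons]
    rw [List.pairwise_map]
    refine List.pairwise_of_forall fun e₁ e₂ => ?_
    by_cases h12 : e₁ = e₂
    · subst h12
      exact Commute.refl _
    split_ifs
    · exact hcomm _ _ h12
    · exact Commute.one_right _
    · exact Commute.one_left _
    · exact Commute.one_left _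
  have hmem : ∀ e' ∈ L, e' ≠ e := fun e' he' => by simpa [hL] using he'
  have hLeq : (L.map fun e' => if (x + pairInd (o.source e) (o.target e))
      (o.source e') = 1 then c (o.target e') * c (o.source e') else 1)
      = L.map fun e' => if x (o.source e') = 1 then c (o.target e') * c (o.source e') else 1 := by
    refine List.map_congr_left fun e' he' => ?_
    obtain ⟨h1, h2, -, -⟩ := hne e' (hmem e' he')
    simp [pairInd, h1, h2]
  have hcommL : Commute (L.map fun e' => if x (o.source e') = 1 then
      c (o.target e') * c (o.source e') else 1).prod (c (o.target e) * c (o.source e)) := by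
    refine (Commute.list_prod_right _ _ fun y hy => ?_).symm
    obtain ⟨e', he', rfl⟩ := List.mem_map.1 hy
    split_ifs
    · exact hcomm _ _ (Ne.symm (hmem e' he'))
    · exact Commute.one_right _
  have hst : o.target e ≠ o.source e := Γ.opp_ne _
  rw [hprod x, hprod (x + _), hLeq, mul_assoc, hcommL.eq, ← mul_assoc, ← smul_mul_assoc]
  congr 1
  have e1 : (x + pairInd (o.source e) (o.target e)) (o.source e)
      = x (o.source e) + 1 := by simp [pairInd, hst.symm]
  rw [e1]
  have z01 : ∀ z : ZMod 2, z = 0 ∨ z = 1 := by decide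
  rcases z01 (x (o.source e)) with h | h
  · simp [h, boolSign]
  · simp [h, boolSign, hc.pair_mul_self hst, show (1 : ZMod 2) + 1 ≠ 1 by decide]

end EmbeddedGraph

/-! ### The Kasteleyn condition and the boundary of a face -/

namespace EmbeddedGraph

variable {H : Type*} {Γ : EmbeddedGraph H} {R : Type*} [Ring R] {c : H → R}

lemma pairInd_comm {H : Type*} [DecidableEq H] (a b : H) : pairInd a b = pairInd b a :=
  add_comm _ _

lemma pairInd_source_target [DecidableEq H] (o : Γ.Orientation) (h : H) :
    pairInd (o.source (Γ.edge h)) (o.target (Γ.edge h)) = pairInd h (Γ.opp h) := by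
  rcases Γ.eq_source_or_eq_target o h with h1 | h1
  · conv_rhs => rw [h1]
    rfl
  · conv_rhs => rw [h1, opp_source_target, pairInd_comm]

/-- The product of the target-source pairs of an edge, compared with the direction in which a face
traverses the edge. -/
lemma target_mul_source (hc : IsCliffordFamily c) (o : Γ.Orientation) (h : H)
    [Decidable (o.target (Γ.edge h) = h)] :
    c (o.target (Γ.edge h)) * c (o.source (Γ.edge h))
      = (if o.target (Γ.edge h) = h then (-1 : ℤ) else 1) • (c (Γ.opp h) * c h) := by
  split_ifs with h1
  · have h2 : o.source (Γ.edge h) = Γ.opp h := by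
      rw [← opp_source_target, h1]
    rw [h1, h2, hc.anticomm _ _ (Γ.opp_ne h).symm, neg_one_smul]
  · have h2 : o.source (Γ.edge h) = h :=
      ((Γ.eq_source_or_eq_target o h).resolve_right (Ne.symm h1)).symm
    rw [one_smul, h2, Orientation.target, h2]

variable [Fintype H]

/-- Iteration of `angleProd_mul`. No angle touches the source of a later one, so every sign can be
read off from the initial `x`. -/
lemma angleProd_mul_prod [DecidableEq H] (hc : IsCliffordFamily c) (hΓ : Γ.IsTrivalent)
    {x : H → ZMod 2} (hx : ∀ h, x h + x (Γ.rot h) + x (Γ.rot (Γ.rot h)) = 0) (a : ℕ → H) (m : ℕ)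
    (ha : ∀ i j, i < j → j < m → a j ≠ a i ∧ a j ≠ Γ.rot (a i)) :
    Γ.angleProd c x * ((List.range m).map fun i => c (a i) * c (Γ.rot (a i))).prod
      = (∏ i ∈ Finset.range m, boolSign (x (a i))) •
        Γ.angleProd c (x + ∑ i ∈ Finset.range m, pairInd (a i) (Γ.rot (a i))) := by
  have heven : ∀ (a h : H), pairInd a (Γ.rot a) h + pairInd a (Γ.rot a) (Γ.rot h)
      + pairInd a (Γ.rot a) (Γ.rot (Γ.rot h)) = 0 := by
    intro a h
    have e1 := hΓ.single_add_rot a h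
    have e2 := hΓ.single_add_rot (Γ.rot a) h
    rw [vertex_rot] at e2
    simp only [pairInd, Pi.add_apply]
    linear_combination e1 + e2 + CharTwo.add_self_eq_zero
      (if Γ.vertex a = Γ.vertex h then (1 : ZMod 2) else 0)
  induction m with
  | zero => simp
  | succ m ih =>
    have h0 : (∑ i ∈ Finset.range m, pairInd (a i) (Γ.rot (a i))) (a m) = 0 := by
      rw [Finset.sum_apply]
      refine Finset.sum_eq_zero fun i hi => ?_
      obtain ⟨h1, h2⟩ := ha i m (Finset.mem_range.1 hi) (Nat.lt_succ_self m)
      simp [pairInd, h1, h2]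
    rw [List.prod_range_succ, ← mul_assoc,
      ih fun i j hij hj => ha i j hij (hj.trans m.lt_succ_self),
      smul_mul_assoc, angleProd_mul hc hΓ, Pi.add_apply, h0, add_zero, smul_smul,
      Finset.prod_range_succ, Finset.sum_range_succ, add_assoc]
    intro h
    have : (∑ i ∈ Finset.range m, pairInd (a i) (Γ.rot (a i))) h
        + (∑ i ∈ Finset.range m, pairInd (a i) (Γ.rot (a i))) (Γ.rot h)
        + (∑ i ∈ Finset.range m, pairInd (a i) (Γ.rot (a i))) (Γ.rot (Γ.rot h)) = 0 := by
      simp only [Finset.sum_apply, ← Finset.sum_add_distrib, heven, Finset.sum_const_zero]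
    simp only [Pi.add_apply]
    linear_combination hx h + this

/-- Iteration of `edgeProd_mul` over distinct edges. -/
lemma edgeProd_mul_prod [DecidableEq H] (hc : IsCliffordFamily c) (o : Γ.Orientation)
    (x : H → ZMod 2) (e : ℕ → Γ.Edge) (m : ℕ) (he : ∀ i j, i < j → j < m → e j ≠ e i) :
    edgeProd c o x * ((List.range m).map fun i => c (o.target (e i)) * c (o.source (e i))).prod
      = (∏ i ∈ Finset.range m, boolSign (x (o.source (e i)))) •
        edgeProd c o
          (x + ∑ i ∈ Finset.range m, pairInd (o.source (e i)) (o.target (e i))) := by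
  induction m with
  | zero => simp
  | succ m ih =>
    have h0 : (∑ i ∈ Finset.range m, pairInd (o.source (e i)) (o.target (e i)))
        (o.source (e m)) = 0 := by
      rw [Finset.sum_apply]
      refine Finset.sum_eq_zero fun i hi => ?_
      have hne := he i m (Finset.mem_range.1 hi) (Nat.lt_succ_self m)
      have h1 : o.source (e m) ≠ o.source (e i) := fun h => hne (by
        rw [← o.edge_source (e m), h, o.edge_source])
      have h2 : o.source (e m) ≠ o.target (e i) := fun h => hne (by
        rw [← o.edge_source (e m), h, edge_target])
      simp [pairInd, h1, h2]
    rw [List.prod_range_succ, ← mul_assoc,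
      ih fun i j hij hj => he i j hij (hj.trans m.lt_succ_self),
      smul_mul_assoc, edgeProd_mul hc, Pi.add_apply, h0, add_zero, smul_smul,
      Finset.prod_range_succ, Finset.sum_range_succ, add_assoc]

/-- The Kasteleyn condition as a sign: the face traverses an odd number of its edges from target to
source. -/
lemma prod_mismatch (o : Γ.Orientation) (ho : o.IsKasteleyn) (h₀ : H)
    [DecidablePred fun k => Γ.face k = Γ.face h₀] [DecidableEq H] :
    ∏ k with Γ.face k = Γ.face h₀, (if o.target (Γ.edge k) = k then (-1 : ℤ) else 1) = -1 := by
  rw [← Finset.prod_filter, Finset.prod_const]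
  refine Odd.neg_one_pow ?_
  classical
  have hodd := ho (Γ.face h₀)
  rw [Nat.card_eq_fintype_card, Fintype.card_subtype] at hodd
  convert hodd using 1
  refine Finset.card_nbij' Γ.edge o.target ?_ ?_ ?_ ?_
  · intro k hk
    simp only [Finset.coe_filter, Finset.mem_filter, Finset.mem_univ, true_and,
      Set.mem_ofPred_eq] at hk ⊢
    rw [hk.2, hk.1]
  · intro e he
    simp only [Finset.coe_filter, Finset.mem_filter, Finset.mem_univ, true_and,
      Set.mem_ofPred_eq] at he ⊢
    exact ⟨he, by rw [edge_target]⟩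
  · intro k hk
    simp only [Finset.coe_filter, Finset.mem_filter, Finset.mem_univ, true_and,
      Set.mem_ofPred_eq] at hk
    exact hk.2
  · intro e _
    exact Γ.edge_target o e

/-- Adding the boundary of a face to an even set of edges preserves the equality of the products
over angles and over edges. -/
lemma angleProd_eq_edgeProd_add_face [DecidableEq H] [DecidableEq Γ.Face]
    (hc : IsCliffordFamily c) (hΓ : Γ.IsTrivalent)
    (hface : ∀ h, Γ.face (Γ.opp h) ≠ Γ.face h) (o : Γ.Orientation) (ho : o.IsKasteleyn)
    {x : H → ZMod 2} (hx : Γ.IsEven x) (hxe : Γ.angleProd c x = edgeProd c o x) (h₀ : H) :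
    Γ.angleProd c (x + fun h => (if Γ.face h = Γ.face h₀ then 1 else 0)
        + (if Γ.face (Γ.opp h) = Γ.face h₀ then 1 else 0))
      = edgeProd c o (x + fun h => (if Γ.face h = Γ.face h₀ then 1 else 0)
        + (if Γ.face (Γ.opp h) = Γ.face h₀ then 1 else 0)) := by
  classical
  -- The boundary walk `φ` of the face. Its angles are `(φ (i + 1), opp (φ i))`.
  set φ : ℕ → H := fun i => Γ.faceNext^[i] h₀ with hφ
  have hpos : 0 < Function.minimalPeriod Γ.faceNext h₀ :=
    Function.minimalPeriod_pos_of_mem_periodicPts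
      ((Function.Injective.mem_periodicPts Γ.faceNext.injective) h₀)
  obtain ⟨n, hn⟩ : ∃ n, Function.minimalPeriod Γ.faceNext h₀ = n + 1 :=
    ⟨_, (Nat.succ_pred_eq_of_pos hpos).symm⟩
  have hφn : φ (n + 1) = φ 0 := by
    have := Function.iterate_minimalPeriod (f := Γ.faceNext) (x := h₀)
    rw [hn] at this
    exact this
  have hφinj : ∀ i j, i < j → j < n + 1 → φ j ≠ φ i := by
    intro i j hij hj e
    have := Γ.iterate_faceNext_injOn h₀ (x₁ := j) (x₂ := i) (by simp [hn, hj])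
      (by simp [hn]; omega) e
    omega
  have hφinj' : ∀ i j, i < j → j < n + 1 → φ (j + 1) ≠ φ (i + 1) := by
    intro i j hij hj e
    refine hφinj i j hij hj (Γ.faceNext.injective ?_)
    simpa only [hφ, Function.iterate_succ_apply'] using e
  have hφf : ∀ i, Γ.face (φ i) = Γ.face h₀ := fun i => Γ.face_iterate h₀ i
  have hφo : ∀ i j, φ i ≠ Γ.opp (φ j) := by
    intro i j e
    apply hface (φ j)
    rw [← e, hφf, hφf]
  have hrot : ∀ i, Γ.rot (φ (i + 1)) = Γ.opp (φ i) := by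
    intro i
    rw [hφ]
    dsimp only
    rw [Function.iterate_succ_apply', rot_faceNext]
  have hA := angleProd_mul_prod hc hΓ hx.rot (fun i => φ (i + 1)) (n + 1) (by
    intro i j hij hj
    exact ⟨hφinj' i j hij hj, (hφo _ _).trans_eq (hrot i).symm⟩)
  have hE := edgeProd_mul_prod hc o x (fun i => Γ.edge (φ i)) (n + 1) (by
    intro i j hij hj e
    rcases Γ.edge_eq_iff.1 e with h | h
    · exact hφinj i j hij hj h
    · exact hφo _ _ h)
  -- The two products of pairs agree by the Kasteleyn condition.
  have hprod : ((List.range (n + 1)).map fun i => c (φ (i + 1)) * c (Γ.rot (φ (i + 1)))).prod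
      = ((List.range (n + 1)).map fun i =>
          c (o.target (Γ.edge (φ i))) * c (o.source (Γ.edge (φ i)))).prod := by
    have h1 := hc.prod_cyclic φ (fun i => Γ.opp (φ i)) n hφo hφn
      (fun i hi => hφinj 0 (i + 1) (Nat.succ_pos i) (by omega))
    simp only [hrot, h1]
    have h2 : ∀ m, ((List.range m).map fun i =>
        c (o.target (Γ.edge (φ i))) * c (o.source (Γ.edge (φ i)))).prod
        = (∏ i ∈ Finset.range m, (if o.target (Γ.edge (φ i)) = φ i then (-1 : ℤ) else 1)) •
          ((List.range m).map fun i => c (Γ.opp (φ i)) * c (φ i)).prod := by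
      intro m
      induction m with
      | zero => simp
      | succ m ih =>
        rw [List.prod_range_succ, ih, target_mul_source hc, List.prod_range_succ,
          Finset.prod_range_succ, smul_mul_smul_comm]
    rw [h2, ← hn, Γ.prod_iterate_faceNext
      (fun k => if o.target (Γ.edge k) = k then (-1 : ℤ) else 1) h₀, prod_mismatch o ho h₀,
      neg_one_smul]
  have hsrc : ∀ k, x (o.source (Γ.edge k)) = x k := by
    intro k
    rcases Γ.eq_source_or_eq_target o k with h1 | h1
    · exact congrArg x h1.symm
    · conv_rhs => rw [h1]
      exact (hx.opp _).symm
  -- The walk closes up, so the signs from the angles are those from the edges.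
  have hsign : ∏ i ∈ Finset.range (n + 1), boolSign (x (φ (i + 1)))
      = ∏ i ∈ Finset.range (n + 1), boolSign (x (φ i)) := by
    rw [Finset.prod_range_succ, hφn, Finset.prod_range_succ' (fun i => boolSign (x (φ i)))]
  have hbd : ∀ f : H → ZMod 2, f = (fun h => (if Γ.face h = Γ.face h₀ then 1 else 0)
        + (if Γ.face (Γ.opp h) = Γ.face h₀ then 1 else 0)) ↔
      f = ∑ i ∈ Finset.range (n + 1), pairInd (φ i) (Γ.opp (φ i)) := by
    intro f
    refine Eq.congr_right ?_
    rw [← hn, Γ.sum_iterate_faceNext (fun k => pairInd k (Γ.opp k)) h₀]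
    ext h
    have hopp : ∀ k, h = Γ.opp k ↔ Γ.opp h = k := fun k =>
      ⟨fun e => by rw [e, Γ.opp_opp], fun e => by rw [← e, Γ.opp_opp]⟩
    rw [Finset.sum_apply, Finset.sum_filter]
    simp only [pairInd, Pi.add_apply, Pi.single_apply, hopp]
    rw [← Finset.sum_filter, Finset.sum_add_distrib, Finset.sum_ite_eq, Finset.sum_ite_eq]
    simp
  have hE' : ∑ i ∈ Finset.range (n + 1),
      pairInd (o.source (Γ.edge (φ i))) (o.target (Γ.edge (φ i)))
      = fun h => (if Γ.face h = Γ.face h₀ then 1 else 0)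
        + (if Γ.face (Γ.opp h) = Γ.face h₀ then 1 else 0) := by
    simp only [pairInd_source_target]
    exact (hbd _).2 rfl
  have hA' : ∑ i ∈ Finset.range (n + 1), pairInd (φ (i + 1)) (Γ.rot (φ (i + 1)))
      = fun h => (if Γ.face h = Γ.face h₀ then 1 else 0)
        + (if Γ.face (Γ.opp h) = Γ.face h₀ then 1 else 0) := by
    refine (hbd _).2 ?_
    simp only [hrot, pairInd, Finset.sum_add_distrib]
    congr 1
    rw [Finset.sum_range_succ, hφn, 
      Finset.sum_range_succ' (fun i => (Pi.single (φ i) 1 : H → ZMod 2))]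
  rw [hprod, hxe, hA', hsign] at hA
  rw [hE'] at hE
  simp only [hsrc] at hE
  rw [hA] at hE
  have hunit : (∏ i ∈ Finset.range (n + 1), boolSign (x (φ i)))
      * (∏ i ∈ Finset.range (n + 1), boolSign (x (φ i))) = 1 := by
    rw [← Finset.prod_mul_distrib]
    refine Finset.prod_eq_one fun i _ => ?_
    rw [boolSign]
    split_ifs <;> norm_num
  have := congrArg (fun y => (∏ i ∈ Finset.range (n + 1), boolSign (x (φ i))) • y) hE
  simpa only [smul_smul, hunit, one_smul] using this

end EmbeddedGraph

/-! ### All even sets of edges have positive sign -/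

/-- The Clifford algebra of a sum of squares is a ring in which signs can be detected. -/
lemma exists_isCliffordFamily (I : Type u) [Fintype I] :
    ∃ (R : Type u) (_ : Ring R) (c : I → R), IsCliffordFamily c ∧ (1 : R) ≠ -1 := by
  classical
  let Q : QuadraticForm ℂ (I → ℂ) := QuadraticMap.weightedSumSquares ℂ (fun _ : I => (1 : ℂ))
  have hQ : ∀ v, Q v = ∑ i, v i * v i := fun v => by
    simp [Q, QuadraticMap.weightedSumSquares_apply]
  refine ⟨CliffordAlgebra Q, inferInstance, fun i => CliffordAlgebra.ι Q (Pi.single i 1), ?_, ?_⟩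
  · constructor
    · intro i j hij
      refine eq_neg_of_add_eq_zero_left ?_
      rw [CliffordAlgebra.ι_mul_ι_add_swap, QuadraticMap.polar, hQ, hQ, hQ,
        ← Finset.sum_sub_distrib, ← Finset.sum_sub_distrib, Finset.sum_eq_zero, map_zero]
      intro k _
      have : (Pi.single i 1 : I → ℂ) k * (Pi.single j 1 : I → ℂ) k = 0 := by
        by_cases hk : k = i
        · rw [Pi.single_eq_of_ne (i := j) (fun h => hij (hk.symm.trans h)), mul_zero]
        · rw [Pi.single_eq_of_ne hk, zero_mul]
      simp only [Pi.add_apply]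
      linear_combination 2 * this
    · intro i
      rw [CliffordAlgebra.ι_sq_scalar, hQ, Finset.sum_eq_single i]
      · simp
      · intro b _ hb
        simp [hb]
      · simp
  · have : Invertible (2 : ℂ) := invertibleOfNonzero two_ne_zero
    have : Nontrivial (CliffordAlgebra Q) := inferInstance
    intro h
    have h1 : algebraMap ℂ (CliffordAlgebra Q) 2 = 0 := by
      rw [map_ofNat, ← one_add_one_eq_two]
      nth_rewrite 2 [h]
      exact add_neg_cancel 1
    exact two_ne_zero ((map_eq_zero_iff _ (algebraMap ℂ (CliffordAlgebra Q)).injective).1 h1)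

lemma List.prod_map_flatMap {α β M : Type*} [Monoid M] (l : List α) (f : α → List β) (g : β → M) :
    ((l.flatMap f).map g).prod = (l.map fun a => ((f a).map g).prod).prod := by
  induction l with
  | nil => rfl
  | cons a l ih => rw [List.flatMap_cons, List.map_append, List.prod_append, ih, List.map_cons,
      List.prod_cons]

namespace EmbeddedGraph

variable {H : Type u} {Γ : EmbeddedGraph H}

/-- At a vertex every face is counted by both half-edges of each of its angles. -/
lemma isEven_faces (c : Γ.Face → ZMod 2) (hrot : ∀ h, Γ.rot (Γ.rot (Γ.rot h)) = h) :
    Γ.IsEven fun h => c (Γ.face h) + c (Γ.face (Γ.opp h)) := by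
  constructor
  · intro h
    rw [Γ.opp_opp, add_comm]
  · intro h
    have hinv : ∀ k, Γ.rot⁻¹ (Γ.rot k) = k := fun k => by simp
    have hlast : Γ.rot⁻¹ h = Γ.rot (Γ.rot h) := by
      conv_lhs => rw [← hrot h]
      exact hinv _
    simp only [face_opp, hinv, hlast]
    generalize c (Γ.face h) = p
    generalize c (Γ.face (Γ.rot h)) = q
    generalize c (Γ.face (Γ.rot (Γ.rot h))) = r
    revert p q r
    decide

variable [Fintype H]

/-- In a Clifford algebra the product of the angles along an even set of edges equals the product
of its edges: the set is a sum of face boundaries. -/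
lemma angleProd_eq_edgeProd (hplanar : Γ.IsPlanar) (hb : Γ.IsBridgeless) (hΓ : Γ.IsTrivalent)
    (o : Γ.Orientation) (ho : o.IsKasteleyn) {R : Type*} [Ring R] {c : H → R}
    (hc : IsCliffordFamily c) {x : H → ZMod 2} (hx : Γ.IsEven x) :
    Γ.angleProd c x = edgeProd c o x := by
  classical
  have hsrc : ∀ k, x (o.source (Γ.edge k)) = x k := by
    intro k
    rcases Γ.eq_source_or_eq_target o k with h1 | h1
    · exact congrArg x h1.symm
    · conv_rhs => rw [h1]
      exact (hx.opp _).symm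
  obtain ⟨d, hd⟩ := hplanar.exists_faceBoundary o (fun e => x (o.source e)) (by
    intro v
    obtain ⟨h, rfl⟩ := Quotient.exists_rep v
    simp only [hsrc]
    exact (hΓ.sum_vertex x h).trans (hx.rot h))
  have key : ∀ T : Finset Γ.Face,
      Γ.angleProd c (fun h => (if Γ.face h ∈ T then 1 else 0)
        + (if Γ.face (Γ.opp h) ∈ T then 1 else 0))
      = edgeProd c o (fun h => (if Γ.face h ∈ T then 1 else 0)
        + (if Γ.face (Γ.opp h) ∈ T then 1 else 0)) := by
    intro T
    induction T using Finset.induction_on with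
    | empty =>
      have : Γ.angleFactor c (fun _ => 0) = fun _ => 1 := by
        ext h
        simp [angleFactor]
      simp [angleProd, this, edgeProd]
    | insert f T hf ih =>
      obtain ⟨h₀, rfl⟩ := Quotient.exists_rep f
      have := angleProd_eq_edgeProd_add_face hc hΓ (fun h => hplanar.face_opp_ne hb o h) o ho
        (isEven_faces (fun f => if f ∈ T then (1 : ZMod 2) else 0) hΓ.rot_rot_rot) ih h₀
      have e : (fun h => (if Γ.face h ∈ insert (Γ.face h₀) T then (1 : ZMod 2) else 0)
          + (if Γ.face (Γ.opp h) ∈ insert (Γ.face h₀) T then 1 else 0))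
          = (fun h => (if Γ.face h ∈ T then 1 else 0) + (if Γ.face (Γ.opp h) ∈ T then 1 else 0))
            + fun h => (if Γ.face h = Γ.face h₀ then 1 else 0)
              + (if Γ.face (Γ.opp h) = Γ.face h₀ then 1 else 0) := by
        have hi : ∀ f', (if f' ∈ insert (Γ.face h₀) T then (1 : ZMod 2) else 0)
            = (if f' ∈ T then 1 else 0) + (if f' = Γ.face h₀ then 1 else 0) := by
          intro f'
          by_cases h1 : f' = Γ.face h₀
          · have : f' ∉ T := h1 ▸ hf
            simp [h1, h1 ▸ this]
          · simp [h1]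
        ext h
        rw [hi, hi, Pi.add_apply]
        ring
      rw [← e] at this
      exact this
  have hxd : x = fun h => (if Γ.face h ∈ {f : Γ.Face | d f = 1}.toFinite.toFinset then 1 else 0)
      + (if Γ.face (Γ.opp h) ∈ {f : Γ.Face | d f = 1}.toFinite.toFinset then 1 else 0) := by
    ext h
    have z : ∀ z : ZMod 2, z = if z = 1 then 1 else 0 := by decide
    rw [← hsrc, hd]
    simp only [Set.Finite.mem_toFinset, Set.mem_ofPred_eq]
    rw [← z, ← z]
  rw [hxd]
  exact key _

/-- Listing the half-edges of an even set along its angles and along its edges gives each of them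
exactly once. -/
lemma perm_angles_edges (hΓ : Γ.IsTrivalent) (o : Γ.Orientation) {x : H → ZMod 2}
    (hx : Γ.IsEven x) :
    (((Finset.univ : Finset H).toList.flatMap fun h =>
        if x h = 1 ∧ x (Γ.rot h) = 1 then [h, Γ.rot h] else []).Perm
      ((Finset.univ : Finset Γ.Edge).toList.flatMap fun e =>
        if x (o.source e) = 1 then [o.target e, o.source e] else [])) ∧
    ((Finset.univ : Finset H).toList.flatMap fun h =>
        if x h = 1 ∧ x (Γ.rot h) = 1 then [h, Γ.rot h] else []).Nodup := by
  classical
  have z01 : ∀ z : ZMod 2, z = 0 ∨ z = 1 := by decide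
  have hn1 : ((Finset.univ : Finset H).toList.flatMap fun h =>
        if x h = 1 ∧ x (Γ.rot h) = 1 then [h, Γ.rot h] else []).Nodup := by
    rw [List.nodup_flatMap]
    constructor
    · intro h _
      split_ifs
      · simpa using (hΓ.rot_ne h).symm
      · simp
    · refine (Finset.nodup_toList _).imp ?_
      intro h k hhk l hl hl'
      dsimp only at hl hl'
      split_ifs at hl with h1
      · split_ifs at hl' with h2
        · simp only [List.mem_cons, List.not_mem_nil, or_false] at hl hl'
          have hbad : ∀ k, x k = 1 → x (Γ.rot k) = 1 → x (Γ.rot (Γ.rot k)) = 1 → False := by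
            intro k e1 e2 e3
            have := hx.rot k
            rw [e1, e2, e3] at this
            exact absurd this (by decide)
          rcases hl with rfl | rfl <;> rcases hl' with e | e
          · exact hhk e
          · subst e
            exact hbad k h2.1 h2.2 h1.2
          · subst e
            exact hbad h h1.1 h1.2 h2.2
          · exact hhk (Γ.rot.injective e)
        · simp at hl'
      · simp at hl
  have hn2 : ((Finset.univ : Finset Γ.Edge).toList.flatMap fun e =>
        if x (o.source e) = 1 then [o.target e, o.source e] else []).Nodup := by
    rw [List.nodup_flatMap]
    constructor
    · intro e _
      split_ifs
      · have : o.target e ≠ o.source e := Γ.opp_ne _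
        simp [this]
      · simp
    · refine (Finset.nodup_toList _).imp ?_
      intro e e' hee l hl hl'
      have h1 : Γ.edge l = e := by
        dsimp only at hl
        split_ifs at hl
        · simp only [List.mem_cons, List.not_mem_nil, or_false] at hl
          rcases hl with rfl | rfl
          · exact Γ.edge_target o e
          · exact o.edge_source e
        · simp at hl
      have h2 : Γ.edge l = e' := by
        dsimp only at hl'
        split_ifs at hl'
        · simp only [List.mem_cons, List.not_mem_nil, or_false] at hl'
          rcases hl' with rfl | rfl
          · exact Γ.edge_target o e'
          · exact o.edge_source e'
        · simp at hl'
      exact hee (h1.symm.trans h2)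
  refine ⟨(List.perm_ext_iff_of_nodup hn1 hn2).2 fun k => ?_, hn1⟩
  have m1 : k ∈ ((Finset.univ : Finset H).toList.flatMap fun h =>
        if x h = 1 ∧ x (Γ.rot h) = 1 then [h, Γ.rot h] else []) ↔ x k = 1 := by
    simp only [List.mem_flatMap, Finset.mem_toList, Finset.mem_univ, true_and]
    constructor
    · rintro ⟨h, hh⟩
      split_ifs at hh with h1
      · simp only [List.mem_cons, List.not_mem_nil, or_false] at hh
        rcases hh with rfl | rfl
        exacts [h1.1, h1.2]
      · simp at hh
    · intro hk
      rcases z01 (x (Γ.rot k)) with h1 | h1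
      · have h2 : x (Γ.rot (Γ.rot k)) = 1 := by
          have := hx.rot k
          rw [hk, h1] at this
          revert this
          generalize x (Γ.rot (Γ.rot k)) = z
          revert z
          decide
        exact ⟨Γ.rot (Γ.rot k), by simp [hΓ.rot_rot_rot, h2, hk]⟩
      · exact ⟨k, by simp [h1, hk]⟩
  have m2 : k ∈ ((Finset.univ : Finset Γ.Edge).toList.flatMap fun e =>
        if x (o.source e) = 1 then [o.target e, o.source e] else []) ↔ x k = 1 := by
    simp only [List.mem_flatMap, Finset.mem_toList, Finset.mem_univ, true_and]
    constructor
    · rintro ⟨e, he⟩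
      split_ifs at he with h1
      · simp only [List.mem_cons, List.not_mem_nil, or_false] at he
        rcases he with rfl | rfl
        exacts [(hx.opp _).trans h1, h1]
      · simp at he
    · intro hk
      refine ⟨Γ.edge k, ?_⟩
      rcases Γ.eq_source_or_eq_target o k with h1 | h1
      · rw [if_pos (h1 ▸ hk)]
        simp [← h1]
      · rw [if_pos ((hx.opp _).symm.trans (h1 ▸ hk : x (o.target (Γ.edge k)) = 1))]
        simp [← h1]
  rw [m1, m2]

open Grassmann

/-- The signs of all terms of the fermionic integral are positive: for an even set of edges of a
planar graph with a Kasteleyn orientation, pairing the variables along angles and along edges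
gives the same element of the Grassmann algebra. -/
lemma prod_angle_pair_eq_prod_edge_pair (hplanar : Γ.IsPlanar) (hb : Γ.IsBridgeless)
    (hΓ : Γ.IsTrivalent) (o : Γ.Orientation) (ho : o.IsKasteleyn) {x : H → ZMod 2}
    (hx : Γ.IsEven x) :
    ∏ h with x h = 1 ∧ x (Γ.rot h) = 1, pair (h, Fermion₂.psi) (Γ.rot h, .psi)
      = ∏ e with x (o.source e) = 1, pair (o.target e, Fermion₂.psi) (o.source e, .psi) := by
  obtain ⟨hperm, hnodup⟩ := perm_angles_edges hΓ o hx
  obtain ⟨ε, hε⟩ := hperm.exists_sign.{u} hnodup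
  have hA : ∀ (R : Type u) [Ring R] (c : H → R),
      (((Finset.univ : Finset H).toList.flatMap fun h =>
        if x h = 1 ∧ x (Γ.rot h) = 1 then [h, Γ.rot h] else []).map c).prod
        = Γ.angleProd c x := by
    intro R _ c
    rw [List.prod_map_flatMap, angleProd]
    congr 1
    refine List.map_congr_left fun h _ => ?_
    rw [angleFactor]
    split_ifs <;> simp
  have hE : ∀ (R : Type u) [Ring R] (c : H → R),
      (((Finset.univ : Finset Γ.Edge).toList.flatMap fun e =>
        if x (o.source e) = 1 then [o.target e, o.source e] else []).map c).prod
        = edgeProd c o x := by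
    intro R _ c
    rw [List.prod_map_flatMap, edgeProd]
    congr 1
    refine List.map_congr_left fun h _ => ?_
    split_ifs <;> simp
  -- The sign of the permutation is computed in a Clifford algebra, where products are invertible.
  have hε1 : ε = 1 := by
    obtain ⟨R, _, c, hc, hne⟩ := exists_isCliffordFamily H
    have h := hε R c hc.anticomm
    rw [hA, hE, angleProd_eq_edgeProd hplanar hb hΓ o ho hc hx] at h
    have hu : IsUnit (edgeProd c o x) := by
      have hcu : ∀ h, IsUnit (c h) := fun h => ⟨⟨c h, c h, hc.sq h, hc.sq h⟩, rfl⟩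
      rw [edgeProd]
      refine List.prod_isUnit fun y hy => ?_
      obtain ⟨e, -, rfl⟩ := List.mem_map.1 hy
      split_ifs
      · exact (hcu _).mul (hcu _)
      · exact isUnit_one
    rcases Int.units_eq_one_or ε with rfl | rfl
    · rfl
    · exfalso
      apply hne
      rw [Units.val_neg, Units.val_one, neg_one_smul] at h
      exact hu.mul_right_cancel (by rw [neg_one_mul, one_mul]; exact h)
  have h := hε (Grassmann (H × Fermion₂)) (fun h => gen (h, .psi)) fun i j _ => gen_mul_gen _ _
  rw [hA, hE, hε1, Units.val_one, one_smul] at h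
  refine Subtype.ext ?_
  rw [Finset.prod_filter, Finset.prod_filter, ← Finset.prod_map_toList, ← Finset.prod_map_toList,
    SubmonoidClass.coe_list_prod, SubmonoidClass.coe_list_prod, List.map_map, List.map_map]
  refine Eq.trans ?_ (h.trans ?_)
  · rw [angleProd]
    congr 1
    refine List.map_congr_left fun h _ => ?_
    rw [angleFactor, Function.comp_apply]
    split_ifs <;> rfl
  · rw [edgeProd]
    congr 1
    refine List.map_congr_left fun h _ => ?_
    rw [Function.comp_apply]
    split_ifs <;> rfl

end EmbeddedGraph

/-! ### The fermionic integral as a sum over even sets of edges -/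

namespace EmbeddedGraph

open Grassmann

variable {H : Type u} {Γ : EmbeddedGraph H}

open Classical in
variable (Γ) in
/-- The indicator function on half-edges of a set of edges. -/
def halfEdgeInd (S : Finset Γ.Edge) (h : H) : ZMod 2 := if Γ.edge h ∈ S then 1 else 0

lemma halfEdgeInd_eq_one {S : Finset Γ.Edge} {h : H} :
    Γ.halfEdgeInd S h = 1 ↔ Γ.edge h ∈ S := by
  rw [halfEdgeInd]
  split_ifs with h1 <;> simp [h1]

/-- If at most one of three angles at a vertex is occupied, then an even number of its half-edges is
covered. -/
lemma sum_pairs_of_exclusive {p q s : Prop} [Decidable (p ∨ s)] [Decidable (q ∨ p)]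
    [Decidable (s ∨ q)] (hpq : p → ¬ q) (hqs : q → ¬ s) (hsp : s → ¬ p) :
    (if p ∨ s then (1 : ZMod 2) else 0) + (if q ∨ p then 1 else 0)
      + (if s ∨ q then 1 else 0) = 0 := by
  have h11 : (1 : ZMod 2) + 1 = 0 := by decide
  by_cases hp : p <;> by_cases hq : q <;> by_cases hs : s <;> simp_all

/-- The variables of an occupied edge: `ψ̄_s ψ̄_t ψ_s ψ_t = -(ψ_s ψ̄_s)(ψ_t ψ̄_t)`. -/
lemma pair_bar_mul_pair (s t : H) :
    pair (s, Fermion₂.psiBar) (t, .psiBar) * pair (s, Fermion₂.psi) (t, .psi)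
      = (-1 : ℂ) • (pair (s, Fermion₂.psi) (s, .psiBar) * pair (t, Fermion₂.psi) (t, .psiBar)) := by
  rw [mul_comm]
  refine Subtype.ext ?_
  change gen (s, Fermion₂.psi) * gen (t, .psi) * (gen (s, .psiBar) * gen (t, .psiBar))
    = (-1 : ℂ) • (gen (s, Fermion₂.psi) * gen (s, .psiBar) * (gen (t, .psi) * gen (t, .psiBar)))
  rw [neg_one_smul, mul_assoc, ← mul_assoc (gen (t, Fermion₂.psi)),
    gen_mul_gen (t, Fermion₂.psi)]
  simp only [neg_mul, mul_neg, mul_assoc]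

variable [Fintype H]

@[to_additive]
lemma prod_halfEdges_mem {M : Type*} [CommMonoid M] (o : Γ.Orientation) (S : Finset Γ.Edge)
    [DecidablePred fun h => Γ.edge h ∈ S] (f : H → M) :
    ∏ h with Γ.edge h ∈ S, f h = ∏ e ∈ S, f (o.source e) * f (o.target e) := by
  classical
  rw [Finset.prod_filter, Γ.prod_halfEdges o]
  simp only [o.edge_source, edge_target]
  rw [← Finset.prod_subset (Finset.subset_univ S)]
  · exact Finset.prod_congr rfl fun e he => by simp [he]
  · intro e _ he
    simp [he]

open Classical in
variable (Γ) in
/-- The dimers that cover the Grassmann variables when the edges in `S` are occupied: `ψ_h ψ̄_h`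
off `S`, `ψ̄ ψ̄` along the edges in `S`, and the angles `ψ ψ` between edges in `S`. -/
def dimers (S : Finset Γ.Edge) : Finset (H ⊕ Γ.Edge ⊕ H) :=
  (Finset.univ.filter fun h => Γ.edge h ∉ S).disjSum
    (S.disjSum (Finset.univ.filter fun h => Γ.edge h ∈ S ∧ Γ.edge (Γ.rot h) ∈ S))

/-- The first variable of a dimer. -/
def dimerFst (o : Γ.Orientation) : H ⊕ Γ.Edge ⊕ H → H × Fermion₂
  | .inl h => (h, .psi)
  | .inr (.inl e) => (o.source e, .psiBar)
  | .inr (.inr h) => (h, .psi)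

/-- The second variable of a dimer. -/
def dimerSnd (o : Γ.Orientation) : H ⊕ Γ.Edge ⊕ H → H × Fermion₂
  | .inl h => (h, .psiBar)
  | .inr (.inl e) => (o.target e, .psiBar)
  | .inr (.inr h) => (Γ.rot h, .psi)

/-- The weight of a dimer, where `X h` is the weight of the angle with source `h`. -/
def dimerWeight (X : H → ℂ) : H ⊕ Γ.Edge ⊕ H → ℂ
  | .inl _ => 1
  | .inr (.inl _) => -1
  | .inr (.inr h) => X h

/-- In a trivalent graph an angle is determined by its source, which is arbitrary. -/
def IsTrivalent.angleEquiv (hΓ : Γ.IsTrivalent) : Γ.Angle ≃ H where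
  toFun α := α.source
  invFun h := ⟨(h, Γ.rot h), (hΓ.rot_ne h).symm, rfl⟩
  left_inv α := Subtype.ext (Prod.ext rfl α.2.2.symm)
  right_inv _ := rfl

lemma complexAction_eq_sum_dimers (hΓ : Γ.IsTrivalent) (o : Γ.Orientation) (X : H → H → ℂ) :
    Γ.complexAction o (fun α => X α.source α.target)
      = ∑ d : H ⊕ Γ.Edge ⊕ H, dimerWeight (fun h => X h (Γ.rot h)) d •
          (gen (dimerFst o d) * gen (dimerSnd o d)) := by
  rw [Fintype.sum_sum_type, Fintype.sum_sum_type, complexAction, ← add_assoc]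
  simp only [dimerWeight, dimerFst, dimerSnd, one_smul, neg_one_smul, Finset.sum_neg_distrib,
    ← sub_eq_add_neg]
  congr 1
  rw [← Equiv.sum_comp hΓ.angleEquiv]
  refine Finset.sum_congr rfl fun α _ => ?_
  have : α.target = Γ.rot α.source := α.2.2
  rw [this]
  rfl

/-- A set of dimers with nonzero integral covers every variable exactly once. Such sets correspond
to the even sets of edges. -/
lemma exists_even_of_berezin_ne_zero (hΓ : Γ.IsTrivalent) (o : Γ.Orientation)
    {K : Finset (H ⊕ Γ.Edge ⊕ H)}
    (hK : berezin (complexMeasure H) ((∏ d ∈ K, pair (dimerFst o d) (dimerSnd o d) :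
      Subalgebra.center ℂ (Grassmann (H × Fermion₂))) : Grassmann (H × Fermion₂)) ≠ 0) :
    ∃ S : Finset Γ.Edge, Γ.IsEven (Γ.halfEdgeInd S) ∧ Γ.dimers S = K := by
  classical
  have hex : ∀ i, ∃ d ∈ K, i = dimerFst o d ∨ i = dimerSnd o d := fun i =>
    exists_mem_of_berezin_ne_zero hK (by
      rcases i with ⟨h, _ | _⟩ <;> simp [complexMeasure])
  have huniq : ∀ d ∈ K, ∀ d' ∈ K, _ → d = d' := fun d hd d' hd' =>
    eq_of_berezin_ne_zero hK hd hd'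
  clear hK
  set S : Finset Γ.Edge := Finset.univ.filter fun e => Sum.inr (Sum.inl e) ∈ K with hS
  have hSmem : ∀ e, e ∈ S ↔ Sum.inr (Sum.inl e) ∈ K := fun e => by simp [hS]
  -- `ψ̄_h` cannot be covered by another dimer than its edge, if that is occupied.
  have hcov : ∀ h, Sum.inr (Sum.inl (Γ.edge h)) ∈ K → ∀ d ∈ K,
      (h, Fermion₂.psiBar) = dimerSnd o d → d = Sum.inr (Sum.inl (Γ.edge h)) := by
    intro h hh d hd hd'
    refine huniq d hd _ hh ?_
    rcases Γ.eq_source_or_eq_target o h with h1 | h1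
    · refine Or.inr (Or.inr (Or.inl ?_))
      rw [← hd', dimerFst, ← h1]
    · refine Or.inr (Or.inr (Or.inr ?_))
      rw [← hd', dimerSnd, ← h1]
  have hP : ∀ h, Sum.inl h ∈ K ↔ Γ.edge h ∉ S := by
    intro h
    rw [hSmem]
    constructor
    · intro h1 h2
      exact absurd (hcov h h2 _ h1 rfl) (by simp)
    · intro h1
      obtain ⟨d, hd, hd'⟩ := hex (h, .psiBar)
      rcases d with k | e | k
      · simp only [dimerFst, dimerSnd, Prod.mk.injEq, and_true, reduceCtorEq, and_false,
          false_or] at hd'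
        rwa [hd']
      · simp only [dimerFst, dimerSnd, Prod.mk.injEq, and_true] at hd'
        exfalso
        apply h1
        rcases hd' with rfl | rfl
        · rwa [o.edge_source]
        · rwa [edge_target]
      · simp [dimerFst, dimerSnd] at hd'
  -- Angles cover only `ψ_h` with `h` on an occupied edge, and each of these exactly once.
  have hW1 : ∀ h, Sum.inr (Sum.inr h) ∈ K → Γ.edge h ∈ S ∧ Γ.edge (Γ.rot h) ∈ S := by
    intro h hh
    constructor
    · by_contra hne
      exact absurd (huniq _ ((hP h).2 hne) _ hh (Or.inl rfl)) (by simp)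
    · by_contra hne
      exact absurd (huniq _ ((hP _).2 hne) _ hh (Or.inr (Or.inl rfl))) (by simp)
  have hW2 : ∀ h, Sum.inr (Sum.inr h) ∈ K → Sum.inr (Sum.inr (Γ.rot h)) ∉ K := by
    intro h hh hh'
    have := huniq _ hh _ hh' (Or.inr (Or.inr (Or.inl rfl)))
    simp only [Sum.inr.injEq] at this
    exact hΓ.rot_ne h this.symm
  have hW3 : ∀ h, Γ.edge h ∈ S →
      Sum.inr (Sum.inr h) ∈ K ∨ Sum.inr (Sum.inr (Γ.rot (Γ.rot h))) ∈ K := by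
    intro h hh
    obtain ⟨d, hd, hd'⟩ := hex (h, .psi)
    rcases d with k | e | k
    · simp only [dimerFst, dimerSnd, Prod.mk.injEq, and_true, reduceCtorEq, and_false,
          or_false] at hd'
      subst hd'
      exact absurd hh ((hP _).1 hd)
    · simp [dimerFst, dimerSnd] at hd'
    · simp only [dimerFst, dimerSnd, Prod.mk.injEq, and_true] at hd'
      rcases hd' with rfl | rfl
      · exact Or.inl hd
      · rw [hΓ.rot_rot_rot]
        exact Or.inr hd
  refine ⟨S, ⟨fun h => by rw [halfEdgeInd, halfEdgeInd, edge_opp], fun h => ?_⟩, ?_⟩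
  · have key : ∀ h, Γ.edge h ∈ S ↔
        Sum.inr (Sum.inr h) ∈ K ∨ Sum.inr (Sum.inr (Γ.rot (Γ.rot h))) ∈ K := by
      refine fun h => ⟨hW3 h, ?_⟩
      rintro (h1 | h1)
      · exact (hW1 h h1).1
      · have := (hW1 _ h1).2
        rwa [hΓ.rot_rot_rot] at this
    have h3 := hΓ.rot_rot_rot h
    have k1 := hW2 h
    have k2 := hW2 (Γ.rot h)
    have k3 := hW2 (Γ.rot (Γ.rot h))
    simp only [halfEdgeInd, key, h3] at k3 ⊢
    exact sum_pairs_of_exclusive k1 k2 k3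
  · ext d
    rcases d with h | e | h
    · simp [dimers, hP]
    · simp [dimers, hSmem]
    · simp only [dimers, Finset.inr_mem_disjSum, Finset.mem_filter, Finset.mem_univ, true_and]
      refine ⟨fun ⟨h1, h2⟩ => ?_, hW1 h⟩
      by_contra hne
      have e1 := (hW3 h h1).resolve_left hne
      have e2 := hW3 _ h2
      rw [hΓ.rot_rot_rot] at e2
      exact hW2 _ (e2.resolve_right hne) e1

/-- The fermionic integral as a sum over even sets of edges, if all signs are positive. -/
lemma fermionZ_eq_sum_even (hΓ : Γ.IsTrivalent) (o : Γ.Orientation) (r : Γ.Edge → ℂ)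
    [DecidablePred fun S : Finset Γ.Edge => Γ.IsEven (Γ.halfEdgeInd S)]
    (hsign : ∀ x, Γ.IsEven x →
      ∏ h with x h = 1 ∧ x (Γ.rot h) = 1, pair (h, Fermion₂.psi) (Γ.rot h, .psi)
        = ∏ e with x (o.source e) = 1, pair (o.source e, Fermion₂.psi) (o.target e, .psi)) :
    Γ.fermionZ o (fun α => r (Γ.edge α.source) * r (Γ.edge α.target))
      = ∑ S : Finset Γ.Edge with Γ.IsEven (Γ.halfEdgeInd S), ∏ e ∈ S, r e ^ 2 := by
  classical
  have hinj : Function.Injective Γ.dimers := by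
    intro S T hST
    ext e
    have := Finset.ext_iff.1 hST (Sum.inr (Sum.inl e))
    simpa [dimers] using this
  rw [fermionZ, complexAction_eq_sum_dimers hΓ o (fun h k => r (Γ.edge h) * r (Γ.edge k)),
    berezin_exp_sum_pair, ← Finset.sum_subset (Finset.subset_univ
      ((Finset.univ.filter fun S => Γ.IsEven (Γ.halfEdgeInd S)).image Γ.dimers)),
    Finset.sum_image hinj.injOn]
  · -- The weights are `(-1) ^ #S ∏ r e ^ 2`, and `pair_bar_mul_pair` gives
    -- the sign `(-1) ^ #S` again.
    refine Finset.sum_congr rfl fun S hS => ?_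
    have hx : Γ.IsEven (Γ.halfEdgeInd S) := (Finset.mem_filter.1 hS).2
    have hs := hsign _ hx
    simp only [halfEdgeInd_eq_one, o.edge_source] at hs
    rw [Finset.filter_mem_eq_inter, Finset.univ_inter] at hs
    have hw : ∏ d ∈ Γ.dimers S, dimerWeight (fun h => r (Γ.edge h) * r (Γ.edge (Γ.rot h))) d
        = (-1) ^ S.card * ∏ e ∈ S, r e ^ 2 := by
      have hp := ((perm_angles_edges hΓ o hx).1.map fun h => r (Γ.edge h)).prod_eq
      rw [List.prod_map_flatMap, List.prod_map_flatMap, Finset.prod_map_toList,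
        Finset.prod_map_toList] at hp
      have e1 : ∀ h, ((if Γ.halfEdgeInd S h = 1 ∧ Γ.halfEdgeInd S (Γ.rot h) = 1 then [h, Γ.rot h]
          else []).map fun h => r (Γ.edge h)).prod
          = if Γ.edge h ∈ S ∧ Γ.edge (Γ.rot h) ∈ S then r (Γ.edge h) * r (Γ.edge (Γ.rot h))
            else 1 := by
        intro h
        simp only [halfEdgeInd_eq_one]
        split_ifs <;> simp
      have e2 : ∀ e, ((if Γ.halfEdgeInd S (o.source e) = 1 then [o.target e, o.source e]
          else []).map fun h => r (Γ.edge h)).prod = if e ∈ S then r e ^ 2 else 1 := by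
        intro e
        simp only [halfEdgeInd_eq_one, o.edge_source]
        split_ifs <;> simp [edge_target, o.edge_source, pow_two]
      rw [Finset.prod_congr rfl fun h _ => e1 h, Finset.prod_congr rfl fun e _ => e2 e,
        ← Finset.prod_filter, ← Finset.prod_filter, Finset.filter_mem_eq_inter,
        Finset.univ_inter] at hp
      rw [dimers, Finset.prod_disjSum, Finset.prod_disjSum]
      simp only [dimerWeight, Finset.prod_const_one, one_mul, Finset.prod_const]
      rw [hp]
    have hm : ∏ d ∈ Γ.dimers S, pair (dimerFst o d) (dimerSnd o d)
        = ((-1 : ℂ) ^ S.card) • ∏ h : H, pair (h, Fermion₂.psi) (h, .psiBar) := by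
      rw [dimers, Finset.prod_disjSum, Finset.prod_disjSum]
      simp only [dimerFst, dimerSnd]
      rw [hs, ← Finset.prod_mul_distrib, Finset.prod_congr rfl fun e _ => pair_bar_mul_pair _ _,
        Finset.prod_smul, Finset.prod_const, ← prod_halfEdges_mem o S fun h =>
          pair (h, Fermion₂.psi) (h, .psiBar), mul_smul_comm, mul_comm,
        Finset.prod_filter_mul_prod_filter_not]
    rw [hw, hm]
    change _ * berezin _ ((-1 : ℂ) ^ S.card • ((∏ h : H, pair (h, Fermion₂.psi) (h, .psiBar) :
      Subalgebra.center ℂ (Grassmann (H × Fermion₂))) : Grassmann (H × Fermion₂))) = _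
    rw [berezin_smul, Γ.berezin_complexMeasure_prod, mul_one, mul_right_comm, ← mul_pow]
    norm_num
  · intro K _ hK
    by_contra hne
    obtain ⟨S, hS, rfl⟩ := exists_even_of_berezin_ne_zero hΓ o (right_ne_zero_of_mul hne)
    exact hK (Finset.mem_image_of_mem _ (by simpa using hS))

/-! ### The high-temperature expansion -/

lemma exp_mul_spin (y : ℝ) (u v : ℤˣ) :
    Real.exp (y * ((u : ℤ) : ℝ) * ((v : ℤ) : ℝ))
      = Real.cosh y * (1 + Real.tanh y * (((u : ℤ) : ℝ) * ((v : ℤ) : ℝ))) := by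
  have h1 : Real.cosh y * Real.tanh y = Real.sinh y := by
    rw [Real.tanh_eq_sinh_div_cosh, mul_div_cancel₀ _ (Real.cosh_pos y).ne']
  rcases Int.units_eq_one_or u with rfl | rfl <;> rcases Int.units_eq_one_or v with rfl | rfl <;>
    simp only [Units.val_one, Units.val_neg, Int.cast_one, Int.cast_neg, mul_one, mul_neg,
      neg_neg] <;>
    ring_nf <;> rw [h1]
  · rw [Real.cosh_add_sinh]
  · rw [Real.cosh_sub_sinh]
  · rw [Real.cosh_sub_sinh]
  · rw [Real.cosh_add_sinh]

lemma sum_units_pow (n : ℕ) : ∑ u : ℤˣ, ((u : ℤ) : ℝ) ^ n = if Even n then 2 else 0 := by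
  have : (Finset.univ : Finset ℤˣ) = {1, -1} := rfl
  rw [this, Finset.sum_pair (by decide)]
  split_ifs with h
  · simp [h.neg_one_pow]; norm_num
  · simp [(Nat.not_even_iff_odd.1 h).neg_one_pow]

/-- Summation over the spins leaves the even sets of edges. -/
lemma sum_spin_prod (hΓ : Γ.IsTrivalent) (o : Γ.Orientation) (S : Finset Γ.Edge)
    [Decidable (Γ.IsEven (Γ.halfEdgeInd S))] :
    ∑ σ : Γ.Vertex → ℤˣ, ∏ e ∈ S, (((σ (Γ.vertex (o.source e)) : ℤ) : ℝ)
        * ((σ (Γ.vertex (o.target e)) : ℤ) : ℝ))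
      = if Γ.IsEven (Γ.halfEdgeInd S) then 2 ^ Nat.card Γ.Vertex else 0 := by
  classical
  set d : Γ.Vertex → ℕ := fun v => (Finset.univ.filter fun h => Γ.edge h ∈ S ∧ Γ.vertex h = v).card
    with hd
  have h1 : ∀ σ : Γ.Vertex → ℤˣ, ∏ e ∈ S, (((σ (Γ.vertex (o.source e)) : ℤ) : ℝ)
        * ((σ (Γ.vertex (o.target e)) : ℤ) : ℝ)) = ∏ v, ((σ v : ℤ) : ℝ) ^ d v := by
    intro σ
    rw [← prod_halfEdges_mem o S fun h => ((σ (Γ.vertex h) : ℤ) : ℝ),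
      ← Finset.prod_fiberwise _ Γ.vertex]
    refine Finset.prod_congr rfl fun v _ => ?_
    rw [Finset.filter_filter, Finset.prod_congr rfl (g := fun _ => ((σ v : ℤ) : ℝ)),
      Finset.prod_const]
    intro h hh
    rw [(Finset.mem_filter.1 hh).2.2]
  have h2 := Finset.prod_univ_sum (fun _ : Γ.Vertex => (Finset.univ : Finset ℤˣ))
    (fun v u => ((u : ℤ) : ℝ) ^ d v)
  rw [Fintype.piFinset_univ] at h2
  rw [Finset.sum_congr rfl fun σ _ => h1 σ, ← h2]
  simp only [sum_units_pow]
  have hev : ∀ h, Even (d (Γ.vertex h)) ↔ Γ.halfEdgeInd S h + Γ.halfEdgeInd S (Γ.rot h)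
      + Γ.halfEdgeInd S (Γ.rot (Γ.rot h)) = 0 := by
    intro h
    rw [← hΓ.sum_vertex, ← ZMod.natCast_eq_zero_iff_even]
    refine Eq.congr_left ?_
    simp only [hd, Finset.card_filter, Nat.cast_sum]
    refine Finset.sum_congr rfl fun k _ => ?_
    rw [halfEdgeInd]
    by_cases a : Γ.edge k ∈ S <;> by_cases b : Γ.vertex k = Γ.vertex h <;> simp [a, b]
  split_ifs with hS
  · rw [Finset.prod_congr rfl (g := fun _ => (2 : ℝ)), Finset.prod_const, Finset.card_univ,
      Nat.card_eq_fintype_card]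
    intro v _
    obtain ⟨h, rfl⟩ := Quotient.exists_rep v
    exact if_pos ((hev h).2 (hS.rot h))
  · obtain ⟨h, hh⟩ : ∃ h, ¬ Even (d (Γ.vertex h)) := by
      by_contra! hall
      exact hS ⟨fun h => by rw [halfEdgeInd, halfEdgeInd, edge_opp], fun h => (hev h).1 (hall h)⟩
    exact Finset.prod_eq_zero (Finset.mem_univ (Γ.vertex h)) (if_neg hh)

/-- The high-temperature expansion of the Ising model. -/
lemma isingZ_eq_sum_even (hΓ : Γ.IsTrivalent) (o : Γ.Orientation) (y : Γ.Edge → ℝ)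
    [DecidablePred fun S : Finset Γ.Edge => Γ.IsEven (Γ.halfEdgeInd S)] :
    Γ.isingZ y o = (∏ e, Real.cosh (y e)) * 2 ^ Nat.card Γ.Vertex *
      ∑ S : Finset Γ.Edge with Γ.IsEven (Γ.halfEdgeInd S), ∏ e ∈ S, Real.tanh (y e) := by
  classical
  simp only [isingZ, isingEnergy, Real.exp_sum, exp_mul_spin, Finset.prod_mul_distrib]
  simp only [Finset.prod_one_add, ← Finset.mul_sum, Finset.powerset_univ]
  rw [Finset.sum_comm, mul_assoc]
  congr 1
  rw [Finset.mul_sum, Finset.sum_filter]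
  refine Finset.sum_congr rfl fun S _ => ?_
  simp only [Finset.prod_mul_distrib, ← Finset.mul_sum]
  simp only [← Finset.prod_mul_distrib]
  rw [sum_spin_prod hΓ o S]
  split_ifs <;> ring

end EmbeddedGraph

end

theorem mainTheorem4 {H : Type*} [Fintype H] (Γ : EmbeddedGraph H)
    (hplanar : Γ.IsPlanar) (hbridgeless : Γ.IsBridgeless) (htrivalent : Γ.IsTrivalent)
    (o : Γ.Orientation) (ho : o.IsKasteleyn) :
    (∀ (y : Γ.Edge → ℝ) (r : Γ.Edge → ℂ), (∀ e, r e ^ 2 = (Real.tanh (y e) : ℂ)) →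
      (Γ.isingZ y o : ℂ) =
        (∏ e, (Real.cosh (y e) : ℂ)) * 2 ^ Nat.card Γ.Vertex *
          Γ.fermionZ o.reverse (fun α => r (Γ.edge α.source) * r (Γ.edge α.target))) ∧
    (∀ (o' : Γ.Orientation) (X : Γ.Angle → ℂ),
      Γ.fermionZ o' X ^ 2 = Γ.doubledFermionZ o' X) := by
  classical
  refine ⟨fun y r hr => ?_, Γ.fermionZ_sq⟩
  rw [EmbeddedGraph.isingZ_eq_sum_even htrivalent o y,
    EmbeddedGraph.fermionZ_eq_sum_even htrivalent o.reverse r]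
  · simp only [hr]
    push_cast
    rfl
  · intro x hx
    rw [EmbeddedGraph.prod_angle_pair_eq_prod_edge_pair hplanar hbridgeless htrivalent o ho hx]
    have h1 : ∀ e, o.reverse.source e = o.target e := fun _ => rfl
    have h2 : ∀ e, o.reverse.target e = o.source e := fun e => Γ.opp_opp _
    have h3 : ∀ e, x (o.target e) = x (o.source e) := fun e => hx.opp _
    simp only [h1, h2, h3]
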